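/- Let $V$ be a finite set of $n$ spins with local Hilbert space $\mathbb C^q$, so that the system has Hilbert space $(\mathbb C^q)^{\otimes V}$, and let $\mathsf d$ be a metric on $V$. Suppose that there are $A>0$, $d\ge 1$ and $r_0>0$ such that $|\{w\in V:\mathsf d(v,w)\le r\}|\le A\,r^d$ for every $v\in V$ and every $r\ge r_0$. Let $\omega$ be a quantum state of the system, write $\langle X\rangle=\operatorname{Tr}[\omega X]$, and suppose that $\omega$ has correlation length $\xi>0$ with constant $C>0$: for any two disjoint nonempty regions $\Lambda_1,\Lambda_2\subset V$ and any self-adjoint operators $h_1,h_2$ acting only on $\Lambda_1$ and $\Lambda_2$, respectively, $$|\langle h_1h_2\rangle-\langle h_1\rangle\langle h_2\rangle|\le C\,\|h_1\|\,\|h_2\|\,e^{-\mathsf d(\Lambda_1,\Lambda_2)/\xi},\qquad \mathsf d(\Lambda_1,\Lambda_2)=\min_{x_1\in\Lambda_1,\,x_2\in\Lambda_2}\mathsf d(x_1,x_2).$$ Let $H$ be a $k$-local self-adjoint operator (a sum of operators acting on at most $k$ spins each), with local norm $$\|H\|_{\mathrm{loc}}=2\min\Big\{\max_{x\in V}\sum_{\Lambda\ni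 x}\|h_\Lambda\| \;:\; H=\sum_{\Lambda\subseteq V,\ |\Lambda|\le k}h_\Lambda,\ h_\Lambda \text{ self-adjoint and acting only on }\Lambda\Big\}>0,$$ where $\|\cdot\|$ is the operator norm. For $x>0$ let $F(x)=\max_{s>0}s\,(x-e^s+1+\tfrac s2)$ and let $s^*(x)>0$ be the unique maximizer. Let $a>0$, $x=ak/\|H\|_{\mathrm{loc}}$, and $$D=\frac{\xi}{kA^2}\big(k\,s^*(x)+F(x)\big),\qquad l=(nD)^{\frac1{2d+1}}.$$ Let $\mathbb P(H\ge c)$ denote the probability that a measurement of $H$ on $\omega$ gives an outcome in $[c,\infty)$. If $l\ge r_0$, then $$\mathbb P\big(H\ge\langle H\rangle+na\big)\le(C+1)\exp\left[-n^{\frac1{2d+1}}\,\frac{F(x)}{k^2A^2\,D^{\frac{2d}{2d+1}}}\right].$$ If instead $l<r_0$ (small $n$), then $$\mathbb P\big(H\ge\langle H\rangle+na\big)\le(C+1)\exp\left[-n\,\frac{F(x)}{k^2A^2\,r_0^{2d}}\right].$$ -/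

import Mathlib

open scoped Matrix.Norms.L2Operator ComplexOrder

noncomputable section

namespace SpinSystem

section Operators

variable {V : Type*} [Fintype V] [DecidableEq V] {q : ℕ}

/-- Linear operators on `(ℂ^q)^{⊗ V}`, as matrices in the computational basis `V → Fin q`.
The norm `‖·‖` on them is the operator norm of the Euclidean (`ℓ²`) norm. -/
abbrev Op (V : Type*) (q : ℕ) : Type _ := Matrix (V → Fin q) (V → Fin q) ℂ

/-- The operator `B ⊗ 𝕀` on the whole system, for `B` acting on the spins in `Λ`. -/
def embed (Λ : Finset V) (B : Matrix (Λ → Fin q) (Λ → Fin q) ℂ) : Op V q :=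
  Matrix.of fun x y =>
    if ∀ v, v ∉ Λ → x v = y v then B (fun v => x v) (fun v => y v) else 0

/-- `X` acts only on the spins in `Λ`. -/
def ActsOn (Λ : Finset V) (X : Op V q) : Prop :=
  ∃ B : Matrix (Λ → Fin q) (Λ → Fin q) ℂ, X = embed Λ B

/-- `X` is a sum of linear operators each acting on at most `k` spins. -/
def IsKLocal (k : ℕ) (X : Op V q) : Prop :=
  ∃ Y : Finset V → Op V q, (∀ Λ, ActsOn Λ (Y Λ)) ∧ X = ∑ Λ with Λ.card ≤ k, Y Λ

/-- `h` is a decomposition `H = ∑_{|Λ| ≤ k} h_Λ` into observables `h_Λ` acting on `Λ`. -/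
structure IsDecomposition (k : ℕ) (H : Op V q) (h : Finset V → Op V q) : Prop where
  isHermitian : ∀ Λ, (h Λ).IsHermitian
  actsOn : ∀ Λ, ActsOn Λ (h Λ)
  sum_eq : H = ∑ Λ with Λ.card ≤ k, h Λ

/-- The largest dependence on a spin, `2 max_x ∑_{Λ ∋ x, |Λ| ≤ k} ‖h_Λ‖`. -/
def dependence (k : ℕ) (h : Finset V → Op V q) : ℝ :=
  2 * ⨆ x : V, ∑ Λ with x ∈ Λ ∧ Λ.card ≤ k, ‖h Λ‖

/-- The local norm of `H`: the minimum of the dependence over all decompositions of `H` into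
observables acting on at most `k` spins each. For `k = |V|` all decompositions are allowed. -/
def localNorm (k : ℕ) (H : Op V q) : ℝ :=
  sInf {b | ∃ h : Finset V → Op V q, IsDecomposition k H h ∧ b = dependence k h}

/-- Density operators. -/
def IsState (ω : Op V q) : Prop := ω.PosSemidef ∧ ω.trace = 1

/-- The expectation `⟨X⟩ = Tr[ω X]`. -/
def expect (ω X : Op V q) : ℂ := (ω * X).trace

/-- The spectral projection of `H` onto the eigenvalues in `[c, ∞)`. -/
def spectralProj {H : Op V q} (hH : H.IsHermitian) (c : ℝ) : Op V q :=
  (hH.eigenvectorUnitary : Op V q) *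
    Matrix.diagonal (fun i => if c ≤ hH.eigenvalues i then (1 : ℂ) else 0) *
    star (hH.eigenvectorUnitary : Op V q)

/-- The probability that measuring `H` on `ω` gives an outcome in `[c, ∞)` (Born rule). -/
def probGE (ω : Op V q) {H : Op V q} (hH : H.IsHermitian) (c : ℝ) : ℝ :=
  (expect ω (spectralProj hH c)).re

end Operators

section Geometry

variable {V : Type*} [MetricSpace V]

/-- The distance `min {d(x₁, x₂) : x₁ ∈ Λ₁, x₂ ∈ Λ₂}` of two (nonempty) regions. -/
def regionDist (Λ₁ Λ₂ : Finset V) : ℝ :=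
  sInf {r | ∃ x₁ ∈ Λ₁, ∃ x₂ ∈ Λ₂, r = dist x₁ x₂}

/-- The balls of radius `r ≥ r₀` contain at most `A r^d` spins. -/
def BallGrowth (V : Type*) [MetricSpace V] (A d r₀ : ℝ) : Prop :=
  ∀ (v : V) (r : ℝ), r₀ ≤ r → ((Metric.closedBall v r).ncard : ℝ) ≤ A * r ^ d

/-- `ω` has correlation length `ξ`, with constant `C`. -/
def HasCorrelationLength [Fintype V] [DecidableEq V] {q : ℕ} (ω : Op V q) (ξ C : ℝ) : Prop :=
  ∀ Λ₁ Λ₂ : Finset V, Λ₁.Nonempty → Λ₂.Nonempty → Disjoint Λ₁ Λ₂ →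
    ∀ h₁ h₂ : Op V q, h₁.IsHermitian → ActsOn Λ₁ h₁ → h₂.IsHermitian → ActsOn Λ₂ h₂ →
      ‖expect ω (h₁ * h₂) - expect ω h₁ * expect ω h₂‖ ≤
        C * ‖h₁‖ * ‖h₂‖ * Real.exp (-(regionDist Λ₁ Λ₂ / ξ))

end Geometry

section Rate

/-- The function `s (x - e^s + 1 + s/2)`. -/
def rateAux (x s : ℝ) : ℝ := s * (x - Real.exp s + 1 + s / 2)

/-- `F(x) = max_{s > 0} s (x - e^s + 1 + s/2)`. -/
def rateF (x : ℝ) : ℝ := sSup (rateAux x '' Set.Ioi 0)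

/-- `s*(x) = argmax_{s > 0} s (x - e^s + 1 + s/2)`; for `x > 0` the maximizer exists and is
unique, see `isMaxOn_sStar` and `eq_sStar`. -/
def sStar (x : ℝ) : ℝ := sSup {s | 0 < s ∧ IsMaxOn (rateAux x) (Set.Ioi 0) s}

theorem exists_unique_max {x : ℝ} (hx : 0 < x) :
    ∃ s, 0 < s ∧ ∀ t, 0 < t → t ≠ s → rateAux x t < rateAux x s := by
  have hd : ∀ s, HasDerivAt (rateAux x) (x - (Real.exp s - 1) * (s + 1)) s := by
    intro s
    have h1 : HasDerivAt (fun s : ℝ => x - Real.exp s + 1 + s / 2) (-Real.exp s + 1 / 2) s := by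
      have := (((Real.hasDerivAt_exp s).const_sub x).add_const 1).add
        ((hasDerivAt_id s).div_const 2)
      exact this
    have := (hasDerivAt_id s).mul h1
    refine this.congr_deriv ?_
    simp only [id]
    ring
  have hcont : Continuous (rateAux x) :=
    continuous_iff_continuousAt.2 fun s => (hd s).continuousAt
  have hmono : ∀ s t, 0 ≤ s → s < t →
      (Real.exp s - 1) * (s + 1) < (Real.exp t - 1) * (t + 1) := by
    intro s t hs hst
    have h1 : Real.exp s < Real.exp t := Real.exp_lt_exp.2 hst
    have h2 : 1 ≤ Real.exp s := Real.one_le_exp hs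
    nlinarith
  obtain ⟨s, ⟨hs0, -⟩, hsx⟩ : ∃ s ∈ Set.Icc (0 : ℝ) x, (Real.exp s - 1) * (s + 1) = x := by
    have hc : ContinuousOn (fun s : ℝ => (Real.exp s - 1) * (s + 1)) (Set.Icc 0 x) := by fun_prop
    apply intermediate_value_Icc hx.le hc
    constructor
    · simp [hx.le]
    · have := Real.add_one_le_exp x
      nlinarith
  have hs : 0 < s := by
    rcases hs0.eq_or_lt with h | h
    · subst h; simp at hsx; linarith
    · exact h
  refine ⟨s, hs, fun t ht hts => ?_⟩
  rcases lt_or_gt_of_ne hts with h | h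
  · have : StrictMonoOn (rateAux x) (Set.Icc 0 s) := by
      apply strictMonoOn_of_deriv_pos (convex_Icc 0 s) hcont.continuousOn
      intro u hu
      rw [interior_Icc] at hu
      rw [(hd u).deriv]
      have := hmono u s hu.1.le hu.2
      linarith
    exact this ⟨ht.le, h.le⟩ ⟨hs.le, le_rfl⟩ h
  · have : StrictAntiOn (rateAux x) (Set.Ici s) := by
      apply strictAntiOn_of_deriv_neg (convex_Ici s) hcont.continuousOn
      intro u hu
      rw [interior_Ici] at hu
      rw [(hd u).deriv]
      have := hmono s u hs.le hu
      linarith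
    exact this (Set.self_mem_Ici) h.le h

theorem sStar_spec {x : ℝ} (hx : 0 < x) :
    0 < sStar x ∧ ∀ t, 0 < t → t ≠ sStar x → rateAux x t < rateAux x (sStar x) := by
  obtain ⟨s, hs, hmax⟩ := exists_unique_max hx
  have hset : {s | 0 < s ∧ IsMaxOn (rateAux x) (Set.Ioi 0) s} = {s} := by
    ext t
    constructor
    · rintro ⟨ht, htm⟩
      by_contra hne
      exact absurd (hmax t ht hne) (not_lt.2 (htm hs))
    · rintro rfl
      refine ⟨hs, fun u hu => ?_⟩
      rcases eq_or_ne u t with rfl | hne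
      · exact le_refl (rateAux x u)
      · exact (hmax u hu hne).le
  have : sStar x = s := by rw [sStar, hset, csSup_singleton]
  rw [this]
  exact ⟨hs, hmax⟩

theorem isMaxOn_sStar {x : ℝ} (hx : 0 < x) :
    0 < sStar x ∧ IsMaxOn (rateAux x) (Set.Ioi 0) (sStar x) := by
  refine ⟨(sStar_spec hx).1, fun u hu => ?_⟩
  rcases eq_or_ne u (sStar x) with h | hne
  · subst h
    exact le_refl (rateAux x (sStar x))
  · exact ((sStar_spec hx).2 u hu hne).le

theorem eq_sStar {x s : ℝ} (hx : 0 < x) (hs : 0 < s)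
    (hmax : IsMaxOn (rateAux x) (Set.Ioi 0) s) : s = sStar x := by
  by_contra hne
  exact absurd ((sStar_spec hx).2 s hs hne) (not_lt.2 (hmax (sStar_spec hx).1))

theorem rateF_eq {x : ℝ} (hx : 0 < x) : rateF x = rateAux x (sStar x) := by
  have h := isMaxOn_sStar hx
  refine IsGreatest.csSup_eq ⟨⟨_, h.1, rfl⟩, ?_⟩
  rintro _ ⟨u, hu, rfl⟩
  exact h.2 hu

end Rate

end SpinSystem

end

/-! The moment generating function of H - ⟨H⟩ is bounded moment by moment. Write H - ⟨H⟩ as a sum of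
centred local terms with norm bounds w = 2‖h_Λ‖ and fix a length l. In the expansion of the r-th
moment, a product in which one term is farther than l from all others has real part at most C
e^(-l/ξ) times the product of the norm bounds, since that term commutes with the rest and has mean
zero (`re_expect_prod_ofFn_le`). Every other product is bounded by its norms, so it remains to weigh
the families without an isolated label.

Deleting one label from such a family isolates only neighbours of that label. This yields a
recursion (`clusterWeight_succ_le`), which for truncations P of the exponential generating function
becomes P' ≤ W (e^(tK) - 1)(1 + tK) P, hence P ≤ exp((W/K) `cumulantBound` (tK))
(`sum_clusterWeight_le`). With L essentially the local norm and at most M spins in each ball of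
radius l, one may take K = kML and W = nL/k.

Markov's inequality (`IsState.probGE_le`) with t = s*/(kM²L) turns the cluster part into
exp(-nF(x)/(k²M²)), because F(x) is the maximum of sx - `cumulantBound` s. The correlation error C
exp(-l/ξ + tnL) is at most C times the same exponential once l/ξ ≥ n(k s* + F)/(kM²)
(`probGE_le_of_scale`). For M = A l^d this reads l^(2d+1) ≥ nD; the two cases of the theorem take
equality, or l = r₀ when equality would fall below r₀. -/

noncomputable section

namespace SpinSystem

/-! ### Families without isolated labels: recursion by deleting a label -/

section Combinatorics

open Finset

variable {ι : Type*}

/-- Every label of the family `f` has another label whose value is adjacent to its own. -/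
def NoIsolated {γ : Type*} (adj : ι → ι → Prop) (f : γ → ι) : Prop :=
  ∀ i, ∃ j, j ≠ i ∧ adj (f i) (f j)

/-- If every label other than `j` has a neighbour, then removing `j` isolates only neighbours of
`j`, and the other labels have no isolated ones among them. -/
theorem exists_isolated_set {γ : Type*} [Fintype γ] {adj : ι → ι → Prop}
    (hsymm : ∀ a b, adj a b → adj b a) (c : ι) (f : γ → ι)
    (h : ∀ i, adj c (f i) ∨ ∃ j, j ≠ i ∧ adj (f i) (f j)) :
    ∃ S : Finset γ, (∀ i ∈ S, adj c (f i)) ∧ (S = ∅ → NoIsolated adj f) ∧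
      NoIsolated adj (fun i : {i // i ∉ S} => f i) := by
  classical
  -- Removing all isolated labels strands nobody: by symmetry, a neighbour of a surviving label has
  -- that label as a neighbour, so it survives too.
  refine ⟨Finset.univ.filter fun i => ¬ ∃ j, j ≠ i ∧ adj (f i) (f j), ?_, ?_, ?_⟩
  · intro i hi
    simp only [mem_filter, mem_univ, true_and] at hi
    exact (h i).resolve_right hi
  · intro hS i
    by_contra hi
    have : i ∈ (∅ : Finset γ) := by
      rw [← hS]
      simpa using hi
    simp at this
  · rintro ⟨i, hi⟩
    simp only [mem_filter, mem_univ, true_and, not_not] at hi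
    obtain ⟨j, hj, hij⟩ := hi
    refine ⟨⟨j, ?_⟩, ?_, hij⟩
    · simp only [mem_filter, mem_univ, true_and, not_not]
      exact ⟨i, hj.symm, hsymm _ _ hij⟩
    · simpa [Subtype.ext_iff] using hj

/-- Removing one label `c` from a family without isolated labels. -/
theorem noIsolated_cases {r : ℕ} {adj : ι → ι → Prop}
    (hsymm : ∀ a b, adj a b → adj b a) (c : ι) (f : Fin r → ι)
    (h : NoIsolated adj (Fin.cons c f : Fin (r + 1) → ι)) :
    (∃ S : Finset (Fin r), S.Nonempty ∧ (∀ i ∈ S, adj c (f i)) ∧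
      NoIsolated adj (fun i : {i // i ∉ S} => f i)) ∨
    ∃ j, adj c (f j) ∧ ∃ S : Finset {i // i ≠ j}, S.Nonempty ∧ (∀ i ∈ S, adj (f j) (f i)) ∧
      NoIsolated adj (fun i : {i // i ∉ S} => f i) := by
  classical
  have h' : ∀ i, adj c (f i) ∨ ∃ j, j ≠ i ∧ adj (f i) (f j) := by
    intro i
    obtain ⟨j, hj, hij⟩ := h i.succ
    induction j using Fin.cases with
    | zero => exact Or.inl (hsymm _ _ (by simpa using hij))
    | succ j => exact Or.inr ⟨j, by simpa using hj, by simpa using hij⟩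
  obtain ⟨S, hS, hS0, hSr⟩ := exists_isolated_set hsymm c f h'
  rcases S.eq_empty_or_nonempty with hSe | hSn
  swap
  · exact Or.inl ⟨S, hSn, hS, hSr⟩
  -- Deleting `c` isolates nothing here, so a neighbour `j` of `c` is deleted as well.
  have hf := hS0 hSe
  obtain ⟨j, hj, hcj⟩ := h 0
  obtain ⟨j, rfl⟩ := Fin.exists_succ_eq.2 hj
  simp only [Fin.cons_zero, Fin.cons_succ] at hcj
  obtain ⟨T, hT, hT0, hTr⟩ := exists_isolated_set (γ := {i // i ≠ j}) hsymm (f j)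
    (fun i => f i) (by
      rintro ⟨i, hi⟩
      obtain ⟨m, hm, him⟩ := hf i
      by_cases hmj : m = j
      · subst hmj
        exact Or.inl (hsymm _ _ him)
      · exact Or.inr ⟨⟨m, hmj⟩, by simpa [Subtype.ext_iff] using hm, him⟩)
  -- If deleting `j` isolates nothing either, the first alternative holds with the singleton of `j`.
  rcases T.eq_empty_or_nonempty with hTe | hTn
  · left
    refine ⟨{j}, by simp, by simpa using hcj, ?_⟩
    rintro ⟨i, hi⟩
    obtain ⟨m, hm, him⟩ := hT0 hTe ⟨i, by simpa using hi⟩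
    exact ⟨⟨m, by simpa using m.2⟩, by simpa [Subtype.ext_iff] using hm, him⟩
  · exact Or.inr ⟨j, hcj, T, hTn, hT, hTr⟩

variable [Fintype ι]

open Classical in
/-- The total weight of the families without isolated labels. -/
def clusterWeight (γ : Type*) [Fintype γ] [DecidableEq γ] (adj : ι → ι → Prop) (w : ι → ℝ) : ℝ :=
  ∑ f : γ → ι, if NoIsolated adj f then ∏ i, w (f i) else 0

theorem clusterWeight_congr {γ δ : Type*} [Fintype γ] [DecidableEq γ] [Fintype δ] [DecidableEq δ]
    (e : γ ≃ δ)
    (adj : ι → ι → Prop) (w : ι → ℝ) : clusterWeight γ adj w = clusterWeight δ adj w := by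
  classical
  unfold clusterWeight
  refine Fintype.sum_equiv (e.arrowCongr (Equiv.refl ι)) _ _ fun f => ?_
  have h1 : NoIsolated adj (e.arrowCongr (Equiv.refl ι) f) ↔ NoIsolated adj f := by
    constructor
    · intro h i
      obtain ⟨j, hj, hij⟩ := h (e i)
      refine ⟨e.symm j, fun h => hj (by simp [← h]), ?_⟩
      simpa using hij
    · intro h i
      obtain ⟨j, hj, hij⟩ := h (e.symm i)
      refine ⟨e j, fun h => hj (by simp [← h]), ?_⟩
      simpa using hij
  have h2 : ∏ i, w (f i) = ∏ i, w (e.arrowCongr (Equiv.refl ι) f i) :=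
    Fintype.prod_equiv e _ _ fun i => by simp
  simp only [h1, h2]

theorem clusterWeight_eq_fin {γ : Type*} [Fintype γ] [DecidableEq γ] (adj : ι → ι → Prop) (w : ι → ℝ) :
    clusterWeight γ adj w = clusterWeight (Fin (Fintype.card γ)) adj w :=
  clusterWeight_congr (Fintype.equivFin γ) adj w

theorem clusterWeight_nonneg (γ : Type*) [Fintype γ] [DecidableEq γ] (adj : ι → ι → Prop) {w : ι → ℝ}
    (hw : ∀ a, 0 ≤ w a) : 0 ≤ clusterWeight γ adj w := by
  classical
  refine Finset.sum_nonneg fun f _ => ?_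
  split_ifs
  · exact prod_nonneg fun i _ => hw _
  · exact le_rfl

open Classical in
/-- The families which are adjacent to `c` on `S` and have no isolated labels off `S`. -/
theorem sum_adj_and_noIsolated {γ : Type*} [Fintype γ] [DecidableEq γ] (S : Finset γ)
    (adj : ι → ι → Prop) (w : ι → ℝ) (c : ι) :
    (∑ f : γ → ι, if (∀ i ∈ S, adj c (f i)) ∧ NoIsolated adj (fun i : {i // i ∉ S} => f i)
      then ∏ i, w (f i) else 0) =
    (∑ b with adj c b, w b) ^ S.card * clusterWeight (Fin (Fintype.card γ - S.card)) adj w := by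
  have hcard : clusterWeight (Fin (Fintype.card γ - S.card)) adj w =
      clusterWeight {i // i ∉ S} adj w := by
    rw [clusterWeight_eq_fin (γ := {i // i ∉ S})]
    rw [Fintype.card_subtype_compl, Fintype.card_coe]
  have hpow : (∑ b with adj c b, w b) ^ S.card =
      ∑ p : {i // i ∈ S} → ι, ∏ i, if adj c (p i) then w (p i) else 0 := by
    have := Finset.prod_univ_sum (fun _ : {i // i ∈ S} => (univ : Finset ι))
      (fun _ b => if adj c b then w b else 0)
    rw [Fintype.piFinset_univ] at this
    rw [← this, prod_const, card_univ, Fintype.card_coe, sum_filter]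
  rw [hcard, hpow, clusterWeight, sum_mul_sum, ← sum_product', univ_product_univ]
  refine Fintype.sum_equiv (Equiv.piEquivPiSubtypeProd (· ∈ S) fun _ => ι) _ _ fun f => ?_
  simp only [Equiv.piEquivPiSubtypeProd_apply]
  by_cases h1 : ∀ i ∈ S, adj c (f i)
  · by_cases h2 : NoIsolated adj (fun i : {i // i ∉ S} => f i)
    · rw [if_pos ⟨h1, h2⟩, if_pos h2, ← Fintype.prod_subtype_mul_prod_subtype (· ∈ S)]
      congr 1
      refine prod_congr (by ext; simp) fun i _ => (if_pos (h1 i i.2)).symm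
    · rw [if_neg (fun h => h2 h.2), if_neg h2, mul_zero]
  · rw [if_neg (fun h => h1 h.1)]
    push Not at h1
    obtain ⟨i, hi, hci⟩ := h1
    rw [prod_eq_zero (mem_univ (⟨i, hi⟩ : {i // i ∈ S})) (if_neg hci), zero_mul]

/-- The binomial convolution of the positive powers of `K` with the cluster weights. -/
def peelWeight (adj : ι → ι → Prop) (w : ι → ℝ) (K : ℝ) (r : ℕ) : ℝ :=
  ∑ m ∈ range (r + 1), (r.choose m : ℝ) *
    ((if m = 0 then 0 else K ^ m) * clusterWeight (Fin (r - m)) adj w)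

-- Grouping the sets S by their size m gives the binomial coefficient; nonemptiness of S is why
-- `peelWeight` drops m = 0.
open Classical in
theorem sum_sum_adj_and_noIsolated (γ : Type*) [Fintype γ] [DecidableEq γ]
    (adj : ι → ι → Prop) (w : ι → ℝ) (c : ι) :
    (∑ f : γ → ι, ∑ S : Finset γ, if S.Nonempty ∧ (∀ i ∈ S, adj c (f i)) ∧
      NoIsolated adj (fun i : {i // i ∉ S} => f i) then ∏ i, w (f i) else 0) =
    peelWeight adj w (∑ b with adj c b, w b) (Fintype.card γ) := by
  have h := sum_powerset_apply_card (x := (univ : Finset γ))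
    (fun m => (if m = 0 then 0 else (∑ b with adj c b, w b) ^ m) *
      clusterWeight (Fin (Fintype.card γ - m)) adj w)
  simp only [powerset_univ, card_univ, nsmul_eq_mul] at h
  rw [peelWeight, ← h, sum_comm]
  refine sum_congr rfl fun S _ => ?_
  rcases S.eq_empty_or_nonempty with rfl | hS
  · simp
  · rw [if_neg hS.card_ne_zero, ← sum_adj_and_noIsolated]
    simp only [hS, true_and]

/-- Only powers m ≥ 1 of `K` occur, and θ^m ≤ θ for those, so one factor θ can be pulled out. -/
theorem peelWeight_mono {adj : ι → ι → Prop} {w : ι → ℝ} (hw : ∀ a, 0 ≤ w a) {K K' θ : ℝ}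
    (hK : 0 ≤ K) (hK' : 0 ≤ K') (hθ0 : 0 ≤ θ) (hθ : θ ≤ 1) (h : K ≤ θ * K') (r : ℕ) :
    peelWeight adj w K r ≤ θ * peelWeight adj w K' r := by
  rw [peelWeight, peelWeight, mul_sum]
  refine sum_le_sum fun m _ => ?_
  have h0 := clusterWeight_nonneg (Fin (r - m)) adj hw
  have key : (if m = 0 then 0 else K ^ m) ≤ θ * (if m = 0 then 0 else K' ^ m) := by
    split_ifs with hm
    · simp
    · calc K ^ m ≤ (θ * K') ^ m := by gcongr
        _ = θ ^ m * K' ^ m := mul_pow ..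
        _ ≤ θ * K' ^ m := by
          gcongr
          exact pow_le_of_le_one hθ0 hθ hm
  calc _ ≤ (r.choose m : ℝ) * ((θ * (if m = 0 then 0 else K' ^ m)) *
        clusterWeight (Fin (r - m)) adj w) := by gcongr
    _ = _ := by ring

theorem peelWeight_nonneg {adj : ι → ι → Prop} {w : ι → ℝ} (hw : ∀ a, 0 ≤ w a) {K : ℝ}
    (hK : 0 ≤ K) (r : ℕ) : 0 ≤ peelWeight adj w K r := by
  refine sum_nonneg fun m _ => ?_
  have h0 := clusterWeight_nonneg (Fin (r - m)) adj hw
  split_ifs <;> positivity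

-- A union bound over the alternatives of `noIsolated_cases` for the first label `c`: either a
-- nonempty set of neighbours of `c` is peeled off the other r labels, or one of the r labels has a
-- value b adjacent to `c` and neighbours of b are peeled off the remaining r - 1.
open Classical in
theorem clusterWeight_succ_le {adj : ι → ι → Prop} (hsymm : ∀ a b, adj a b → adj b a)
    {w : ι → ℝ} (hw : ∀ a, 0 ≤ w a) (r : ℕ) :
    clusterWeight (Fin (r + 1)) adj w ≤
      ∑ c, w c * (peelWeight adj w (∑ b with adj c b, w b) r +
        r * ∑ b with adj c b, w b * peelWeight adj w (∑ b' with adj b b', w b') (r - 1)) := by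
  have h1 : clusterWeight (Fin (r + 1)) adj w = ∑ c, ∑ f : Fin r → ι,
      if NoIsolated adj (Fin.cons c f : Fin (r + 1) → ι) then w c * ∏ i, w (f i) else 0 := by
    rw [clusterWeight, ← Fintype.sum_prod_type']
    refine Fintype.sum_equiv (Fin.consEquiv fun _ => ι).symm _ _ fun f => ?_
    have : f = Fin.cons (f 0) (Fin.tail f) := (Fin.cons_self_tail f).symm
    simp only [Fin.consEquiv, Equiv.coe_fn_symm_mk, Fin.cons_self_tail, Fin.prod_univ_succ]
    rfl
  rw [h1]
  refine sum_le_sum fun c _ => ?_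
  -- Splitting off the value b = `f j` leaves a free family on the other labels, whose sum is a
  -- `peelWeight` around b.
  have h2 : ∀ j : Fin r, (∑ f : Fin r → ι, ∑ S : Finset {i // i ≠ j},
      if adj c (f j) ∧ S.Nonempty ∧ (∀ i ∈ S, adj (f j) (f i)) ∧
        NoIsolated adj (fun i : {i // i ∉ S} => f i) then ∏ i, w (f i) else 0) =
      ∑ b with adj c b, w b * peelWeight adj w (∑ b' with adj b b', w b') (r - 1) := by
    intro j
    have hc : Fintype.card {i // i ≠ j} = r - 1 := by simp
    simp only [← hc, ← sum_sum_adj_and_noIsolated]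
    rw [sum_filter]
    simp only [mul_sum]
    have : ∀ b, (if adj c b then ∑ f : {i // i ≠ j} → ι, ∑ S : Finset {i // i ≠ j},
        w b * (if S.Nonempty ∧ (∀ i ∈ S, adj b (f i)) ∧
        NoIsolated adj (fun i : {i // i ∉ S} => f i) then ∏ i, w (f i) else 0) else 0) =
        ∑ f : {i // i ≠ j} → ι, if adj c b then ∑ S : Finset {i // i ≠ j},
        w b * (if S.Nonempty ∧ (∀ i ∈ S, adj b (f i)) ∧
        NoIsolated adj (fun i : {i // i ∉ S} => f i) then ∏ i, w (f i) else 0) else 0 := by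
      intro b
      split_ifs <;> simp
    rw [sum_congr (rfl : (univ : Finset ι) = univ) fun b _ => this b]
    conv_rhs => rw [← Fintype.sum_prod_type']
    refine Fintype.sum_equiv (Equiv.funSplitAt j ι) _ _ fun f => ?_
    simp only [Equiv.funSplitAt_apply]
    by_cases hcj : adj c (f j)
    · rw [if_pos hcj]
      refine sum_congr rfl fun S _ => ?_
      rw [mul_ite, mul_zero]
      refine if_congr (by tauto) ?_ rfl
      exact Fintype.prod_eq_mul_prod_subtype_ne (fun i => w (f i)) j
    · rw [if_neg hcj]
      exact sum_eq_zero fun S _ => if_neg fun h => hcj h.1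
  have h3 : (r : ℝ) * ∑ b with adj c b,
      w b * peelWeight adj w (∑ b' with adj b b', w b') (r - 1) =
      ∑ f : Fin r → ι, ∑ j, ∑ S : Finset {i // i ≠ j},
      if adj c (f j) ∧ S.Nonempty ∧ (∀ i ∈ S, adj (f j) (f i)) ∧
        NoIsolated adj (fun i : {i // i ∉ S} => f i) then ∏ i, w (f i) else 0 := by
    rw [sum_comm, sum_congr rfl fun j _ => h2 j]
    simp
  have h4 := sum_sum_adj_and_noIsolated (Fin r) adj w c
  rw [Fintype.card_fin] at h4
  rw [h3, ← h4, ← sum_add_distrib (s := (univ : Finset (Fin r → ι))), mul_sum]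
  refine sum_le_sum fun f _ => ?_
  have hp : 0 ≤ ∏ i, w (f i) := prod_nonneg fun i _ => hw _
  split_ifs with h
  · refine mul_le_mul_of_nonneg_left ?_ (hw c)
    rcases noIsolated_cases hsymm c f h with ⟨S, hS⟩ | ⟨j, hj, S, hS⟩
    · refine le_add_of_le_of_nonneg ?_ ?_
      · refine le_trans ?_ (single_le_sum (fun T _ => ?_) (mem_univ S))
        · rw [if_pos hS]
        · split_ifs <;> simp [hp]
      · refine sum_nonneg fun j _ => sum_nonneg fun S _ => ?_
        split_ifs <;> simp [hp]
    · refine le_add_of_nonneg_of_le ?_ ?_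
      · refine sum_nonneg fun S _ => ?_
        split_ifs <;> simp [hp]
      · refine le_trans ?_ (single_le_sum (fun j _ => sum_nonneg fun T _ => ?_) (mem_univ j))
        · refine le_trans ?_ (single_le_sum (fun T _ => ?_) (mem_univ S))
          · rw [if_pos ⟨hj, hS⟩]
          · split_ifs <;> simp [hp]
        · split_ifs <;> simp [hp]
  · refine mul_nonneg (hw c) (add_nonneg ?_ ?_)
    · refine sum_nonneg fun S _ => ?_
      split_ifs <;> simp [hp]
    · refine sum_nonneg fun j _ => sum_nonneg fun S _ => ?_
      split_ifs <;> simp [hp]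

/-! ### Truncated exponential generating functions -/

theorem sum_range_conv_le {a b : ℕ → ℝ} (ha : ∀ m, 0 ≤ a m) (hb : ∀ m, 0 ≤ b m) (R : ℕ) :
    ∑ r ∈ range R, ∑ m ∈ range (r + 1), a m * b (r - m) ≤
      (∑ m ∈ range R, a m) * ∑ m ∈ range R, b m := by
  rw [sum_comm' (t' := range R) (s' := fun m => Ico m R)
    (by intro x y; simp only [mem_range, mem_Ico]; omega), sum_mul]
  refine sum_le_sum fun m _ => ?_
  rw [← mul_sum, sum_Ico_eq_sum_range]
  refine mul_le_mul_of_nonneg_left ?_ (ha m)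
  simp only [Nat.add_sub_cancel_left]
  exact sum_le_sum_of_subset_of_nonneg (range_mono (Nat.sub_le R m)) fun i _ _ => hb i

theorem sum_pow_div_factorial_le {u : ℝ} (hu : 0 ≤ u) (R : ℕ) :
    ∑ m ∈ range R, (if m = 0 then 0 else u ^ m) / (m.factorial : ℝ) ≤ Real.exp u - 1 := by
  have h := Real.sum_le_exp_of_nonneg hu (R + 1)
  rw [sum_range_succ'] at h
  simp only [pow_zero, Nat.factorial_zero, Nat.cast_one, div_one] at h
  rcases R with _ | R
  · simp [hu]
  · rw [sum_range_succ']
    rw [sum_range_succ] at h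
    simp only [Nat.add_eq_zero_iff, one_ne_zero, and_false, if_false, if_true, zero_div, add_zero]
    have : 0 ≤ u ^ (R + 1) / ((R + 1).factorial : ℝ) := by positivity
    linarith

/-- A binomial convolution is a product of exponential generating functions; truncating it only
loses nonnegative terms. -/
theorem sum_peelWeight_le {adj : ι → ι → Prop} {w : ι → ℝ} (hw : ∀ a, 0 ≤ w a) {K t : ℝ}
    (hK : 0 ≤ K) (ht : 0 ≤ t) (R : ℕ) :
    ∑ r ∈ range R, peelWeight adj w K r * t ^ r / r.factorial ≤
      (Real.exp (t * K) - 1) *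
        ∑ r ∈ range R, clusterWeight (Fin r) adj w * t ^ r / r.factorial := by
  have hN : ∀ r : ℕ, 0 ≤ clusterWeight (Fin r) adj w * t ^ r / r.factorial := fun r => by
    have := clusterWeight_nonneg (Fin r) adj hw
    positivity
  calc _ = ∑ r ∈ range R, ∑ m ∈ range (r + 1),
        ((if m = 0 then 0 else (t * K) ^ m) / (m.factorial : ℝ)) *
        (clusterWeight (Fin (r - m)) adj w * t ^ (r - m) / (r - m).factorial) := by
        refine sum_congr rfl fun r _ => ?_
        rw [peelWeight, sum_mul, sum_div]
        refine sum_congr rfl fun m hm => ?_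
        have hmr : m ≤ r := by simpa [Nat.lt_succ_iff] using hm
        rw [Nat.cast_choose ℝ hmr]
        have ht' : t ^ r = t ^ m * t ^ (r - m) := by rw [← pow_add]; congr 1; omega
        rw [ht']
        split_ifs
        · simp
        · rw [mul_pow]
          field_simp
    _ ≤ _ := sum_range_conv_le (fun m => by split_ifs <;> positivity) hN R
    _ ≤ _ := mul_le_mul_of_nonneg_right (sum_pow_div_factorial_le (by positivity) R)
        (sum_nonneg fun r _ => hN r)

-- Both terms of `clusterWeight_succ_le` contain at least one sum over neighbours of `c`, hence a
-- factor `θ c`. Keeping that one factor gives Σ w θ in front instead of Σ w; with θ = |supp|/k this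
-- later saves a factor k.
open Classical in
theorem clusterWeight_succ_le_peelWeight {adj : ι → ι → Prop} (hsymm : ∀ a b, adj a b → adj b a)
    {w : ι → ℝ} (hw : ∀ a, 0 ≤ w a) {K W : ℝ} (hK : 0 ≤ K) {θ : ι → ℝ} (hθ0 : ∀ c, 0 ≤ θ c)
    (hθ1 : ∀ c, θ c ≤ 1) (hθ : ∀ c, ∑ b with adj c b, w b ≤ θ c * K)
    (hW : ∑ c, w c * θ c ≤ W) (r : ℕ) :
    clusterWeight (Fin (r + 1)) adj w ≤
      W * (peelWeight adj w K r + r * (K * peelWeight adj w K (r - 1))) := by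
  have hK0 : ∀ c, 0 ≤ ∑ b with adj c b, w b := fun c => sum_nonneg fun b _ => hw b
  have hq := peelWeight_nonneg (adj := adj) hw hK
  have h1 : ∀ b s, peelWeight adj w (∑ b' with adj b b', w b') s ≤ peelWeight adj w K s :=
    fun b s => (peelWeight_mono hw (hK0 b) hK (hθ0 b) (hθ1 b) (hθ b) s).trans
      (mul_le_of_le_one_left (hq s) (hθ1 b))
  have h2 : ∀ c, ∑ b with adj c b, w b * peelWeight adj w (∑ b' with adj b b', w b') (r - 1) ≤
      θ c * (K * peelWeight adj w K (r - 1)) := by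
    intro c
    calc _ ≤ ∑ b with adj c b, w b * peelWeight adj w K (r - 1) :=
          sum_le_sum fun b _ => mul_le_mul_of_nonneg_left (h1 b _) (hw b)
      _ ≤ (θ c * K) * peelWeight adj w K (r - 1) := by
          rw [← sum_mul]
          exact mul_le_mul_of_nonneg_right (hθ c) (hq _)
      _ = _ := by ring
  calc _ ≤ _ := clusterWeight_succ_le hsymm hw r
    _ ≤ ∑ c, w c * (θ c * peelWeight adj w K r +
        r * (θ c * (K * peelWeight adj w K (r - 1)))) := by
      refine sum_le_sum fun c _ => mul_le_mul_of_nonneg_left ?_ (hw c)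
      exact add_le_add (peelWeight_mono hw (hK0 c) hK (hθ0 c) (hθ1 c) (hθ c) r)
        (mul_le_mul_of_nonneg_left (h2 c) (Nat.cast_nonneg r))
    _ = (∑ c, w c * θ c) * (peelWeight adj w K r + r * (K * peelWeight adj w K (r - 1))) := by
      rw [sum_mul]
      exact sum_congr rfl fun c _ => by ring
    _ ≤ _ := mul_le_mul_of_nonneg_right hW (add_nonneg (hq r)
        (mul_nonneg (Nat.cast_nonneg r) (mul_nonneg hK (hq _))))

/-- An index shift multiplies the generating function by t. The truncated `r - 1` at r = 0 is
harmless because of the factor r. -/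
theorem sum_shift_peelWeight_le {adj : ι → ι → Prop} {w : ι → ℝ} (hw : ∀ a, 0 ≤ w a) {K t : ℝ}
    (hK : 0 ≤ K) (ht : 0 ≤ t) (R : ℕ) :
    ∑ r ∈ range R, r * peelWeight adj w K (r - 1) * t ^ r / r.factorial ≤
      t * ∑ r ∈ range R, peelWeight adj w K r * t ^ r / r.factorial := by
  have hq : ∀ r, 0 ≤ peelWeight adj w K r * t ^ r / r.factorial := fun r => by
    have := peelWeight_nonneg (adj := adj) hw hK r
    positivity
  rcases R with _ | R
  · simp
  · rw [sum_range_succ']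
    simp only [Nat.cast_zero, zero_mul, zero_div, add_zero]
    rw [mul_sum]
    calc _ = ∑ r ∈ range R, t * (peelWeight adj w K r * t ^ r / r.factorial) := by
          refine sum_congr rfl fun r _ => ?_
          rw [Nat.add_sub_cancel, Nat.factorial_succ, pow_succ]
          push_cast
          field_simp
      _ ≤ _ := sum_le_sum_of_subset_of_nonneg (range_mono (Nat.le_succ R))
          fun r _ _ => mul_nonneg ht (hq r)

/-- The cumulant bound `u (e^u - 1 - u / 2)`. -/
def cumulantBound (u : ℝ) : ℝ := u * (Real.exp u - 1 - u / 2)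

theorem hasDerivAt_cumulantBound (u : ℝ) :
    HasDerivAt cumulantBound ((Real.exp u - 1) * (1 + u)) u := by
  have h1 : HasDerivAt (fun u : ℝ => Real.exp u - 1 - u / 2) (Real.exp u - 1 / 2) u :=
    ((Real.hasDerivAt_exp u).sub_const 1).sub ((hasDerivAt_id u).div_const 2)
  refine ((hasDerivAt_id u).mul h1).congr_deriv ?_
  simp only [id]
  ring

open Classical in
/-- The exponential generating function of the families without isolated labels. -/
theorem sum_clusterWeight_le {adj : ι → ι → Prop} (hsymm : ∀ a b, adj a b → adj b a)
    {w : ι → ℝ} (hw : ∀ a, 0 ≤ w a) {K W : ℝ} (hK : 0 < K) {θ : ι → ℝ} (hθ0 : ∀ c, 0 ≤ θ c)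
    (hθ1 : ∀ c, θ c ≤ 1) (hθ : ∀ c, ∑ b with adj c b, w b ≤ θ c * K)
    (hW : ∑ c, w c * θ c ≤ W) {t : ℝ} (ht : 0 ≤ t) (R : ℕ) :
    ∑ r ∈ range R, clusterWeight (Fin r) adj w * t ^ r / r.factorial ≤
      Real.exp (W / K * cumulantBound (t * K)) := by
  have hW0 : 0 ≤ W := le_trans (sum_nonneg fun c _ => mul_nonneg (hw c) (hθ0 c)) hW
  set N : ℕ → ℝ := fun r => clusterWeight (Fin r) adj w with hN
  have hN0 : ∀ r, 0 ≤ N r := fun r => clusterWeight_nonneg (Fin r) adj hw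
  set P : ℝ → ℝ := fun t => ∑ r ∈ range R, N r * t ^ r / r.factorial with hP
  have hPd : ∀ t, HasDerivAt P (∑ r ∈ range (R - 1), N (r + 1) * t ^ r / r.factorial) t := by
    intro t
    have h1 : HasDerivAt P (∑ r ∈ range R, N r * (r * t ^ (r - 1)) / r.factorial) t :=
      HasDerivAt.fun_sum fun r _ => ((hasDerivAt_pow r t).const_mul (N r)).div_const _
    refine h1.congr_deriv ?_
    rcases R with _ | R
    · simp
    · rw [sum_range_succ']
      simp only [Nat.cast_zero, zero_mul, mul_zero, zero_div, add_zero, Nat.add_sub_cancel]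
      refine sum_congr rfl fun r _ => ?_
      rw [Nat.factorial_succ]
      push_cast
      field_simp
  -- The coefficient of `P t` on the right is exactly the derivative of W/K * `cumulantBound` (tK).
  have hPle : ∀ t, 0 ≤ t → ∑ r ∈ range (R - 1), N (r + 1) * t ^ r / r.factorial ≤
      W * ((Real.exp (t * K) - 1) * (1 + t * K)) * P t := by
    intro t ht
    calc _ ≤ ∑ r ∈ range R, N (r + 1) * t ^ r / r.factorial :=
          sum_le_sum_of_subset_of_nonneg (range_mono (Nat.sub_le R 1)) fun r _ _ => by
            have := hN0 (r + 1)
            positivity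
      _ ≤ ∑ r ∈ range R, (W * (peelWeight adj w K r + r * (K * peelWeight adj w K (r - 1)))) *
          t ^ r / r.factorial := by
        refine sum_le_sum fun r _ => ?_
        have := clusterWeight_succ_le_peelWeight hsymm hw hK.le hθ0 hθ1 hθ hW r
        gcongr
      _ = W * (∑ r ∈ range R, peelWeight adj w K r * t ^ r / r.factorial +
          K * ∑ r ∈ range R, r * peelWeight adj w K (r - 1) * t ^ r / r.factorial) := by
        rw [mul_sum, ← sum_add_distrib, mul_sum]
        exact sum_congr rfl fun r _ => by ring
      _ ≤ W * (∑ r ∈ range R, peelWeight adj w K r * t ^ r / r.factorial +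
          K * (t * ∑ r ∈ range R, peelWeight adj w K r * t ^ r / r.factorial)) := by
        have := sum_shift_peelWeight_le (adj := adj) hw hK.le ht R
        gcongr
      _ = W * (1 + t * K) * ∑ r ∈ range R, peelWeight adj w K r * t ^ r / r.factorial := by ring
      _ ≤ W * (1 + t * K) * ((Real.exp (t * K) - 1) * P t) := by
        have := sum_peelWeight_le (adj := adj) hw hK.le ht R
        gcongr
      _ = _ := by ring
  have hE : ∀ t, HasDerivAt (fun t => Real.exp (-(W / K * cumulantBound (t * K))))
      (Real.exp (-(W / K * cumulantBound (t * K))) *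
        (-(W * ((Real.exp (t * K) - 1) * (1 + t * K))))) t := by
    intro t
    have h1 : HasDerivAt (fun t => cumulantBound (t * K))
        ((Real.exp (t * K) - 1) * (1 + t * K) * K) t := by
      have h2 : HasDerivAt (fun t : ℝ => t * K) K t := by
        simpa using (hasDerivAt_id t).mul_const K
      exact (hasDerivAt_cumulantBound (t * K)).comp t h2
    refine ((h1.const_mul (W / K)).fun_neg.exp).congr_deriv ?_
    field_simp
  -- Grönwall by the integrating factor.
  have hanti : AntitoneOn (fun t => P t * Real.exp (-(W / K * cumulantBound (t * K))))
      (Set.Ici 0) := by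
    have hd := fun t => (hPd t).mul (hE t)
    refine antitoneOn_of_deriv_nonpos (convex_Ici 0)
      (fun t _ => (hd t).continuousAt.continuousWithinAt)
      (fun t _ => (hd t).differentiableAt.differentiableWithinAt) fun t ht => ?_
    rw [interior_Ici] at ht
    have h1 := hPle t (le_of_lt ht)
    have h2 := Real.exp_pos (-(W / K * cumulantBound (t * K)))
    refine (hd t).deriv.trans_le ?_
    nlinarith [mul_le_mul_of_nonneg_right h1 h2.le]
  have h0 := hanti (Set.self_mem_Ici) (Set.mem_Ici.2 ht) ht
  have hP1 : P 0 ≤ 1 := by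
    rcases R with _ | R
    · simp [hP]
    · rw [hP]
      simp only [sum_range_succ']
      have : N 0 = 1 := by
        simp [hN, clusterWeight, NoIsolated]
      simp [this]
  have h00 : cumulantBound (0 * K) = 0 := by simp [cumulantBound]
  simp only [h00, mul_zero, neg_zero, Real.exp_zero, mul_one] at h0
  rw [Real.exp_neg, ← div_eq_mul_inv, div_le_iff₀ (Real.exp_pos _)] at h0
  refine h0.trans ?_
  have := Real.exp_pos (W / K * cumulantBound (t * K))
  nlinarith

end Combinatorics

/-! ### Operators acting on a region -/

section ActsOn

open scoped Kronecker

variable {V : Type*} [Fintype V] [DecidableEq V] {q : ℕ}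

theorem embed_eq_submatrix (Λ : Finset V) (B : Matrix (Λ → Fin q) (Λ → Fin q) ℂ) :
    embed Λ B = (B ⊗ₖ (1 : Matrix ({v // v ∉ Λ} → Fin q) ({v // v ∉ Λ} → Fin q) ℂ)).submatrix
      (Equiv.piEquivPiSubtypeProd (· ∈ Λ) fun _ => Fin q)
      (Equiv.piEquivPiSubtypeProd (· ∈ Λ) fun _ => Fin q) := by
  ext x y
  simp [embed, Matrix.one_apply, funext_iff]

theorem embed_mul (Λ : Finset V) (B B' : Matrix (Λ → Fin q) (Λ → Fin q) ℂ) :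
    embed Λ (B * B') = embed Λ B * embed Λ B' := by
  simp only [embed_eq_submatrix, Matrix.submatrix_mul_equiv, ← Matrix.mul_kronecker_mul, mul_one]

theorem embed_one (Λ : Finset V) : embed Λ (1 : Matrix (Λ → Fin q) (Λ → Fin q) ℂ) = 1 := by
  rw [embed_eq_submatrix, Matrix.one_kronecker_one, Matrix.submatrix_one_equiv]

theorem embed_add (Λ : Finset V) (B B' : Matrix (Λ → Fin q) (Λ → Fin q) ℂ) :
    embed Λ (B + B') = embed Λ B + embed Λ B' := by
  ext x y
  simp only [embed, Matrix.of_apply, Matrix.add_apply]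
  split_ifs <;> simp

theorem embed_smul (Λ : Finset V) (c : ℂ) (B : Matrix (Λ → Fin q) (Λ → Fin q) ℂ) :
    embed Λ (c • B) = c • embed Λ B := by
  ext x y
  simp only [embed, Matrix.of_apply, Matrix.smul_apply]
  split_ifs <;> simp

theorem embed_conjTranspose (Λ : Finset V) (B : Matrix (Λ → Fin q) (Λ → Fin q) ℂ) :
    (embed Λ B).conjTranspose = embed Λ B.conjTranspose := by
  ext x y
  have : (∀ v, v ∉ Λ → y v = x v) ↔ ∀ v, v ∉ Λ → x v = y v :=
    forall₂_congr fun v _ => eq_comm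
  simp only [embed, Matrix.of_apply, Matrix.conjTranspose_apply, this]
  split_ifs <;> simp

theorem actsOn_one (Λ : Finset V) : ActsOn Λ (1 : Op V q) := ⟨1, (embed_one Λ).symm⟩

theorem ActsOn.mul {Λ : Finset V} {X Y : Op V q} (hX : ActsOn Λ X) (hY : ActsOn Λ Y) :
    ActsOn Λ (X * Y) := by
  obtain ⟨B, rfl⟩ := hX
  obtain ⟨B', rfl⟩ := hY
  exact ⟨_, (embed_mul Λ B B').symm⟩

theorem ActsOn.add {Λ : Finset V} {X Y : Op V q} (hX : ActsOn Λ X) (hY : ActsOn Λ Y) :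
    ActsOn Λ (X + Y) := by
  obtain ⟨B, rfl⟩ := hX
  obtain ⟨B', rfl⟩ := hY
  exact ⟨_, (embed_add Λ B B').symm⟩

theorem ActsOn.smul {Λ : Finset V} {X : Op V q} (hX : ActsOn Λ X) (c : ℂ) :
    ActsOn Λ (c • X) := by
  obtain ⟨B, rfl⟩ := hX
  exact ⟨_, (embed_smul Λ c B).symm⟩

theorem ActsOn.conjTranspose {Λ : Finset V} {X : Op V q} (hX : ActsOn Λ X) :
    ActsOn Λ X.conjTranspose := by
  obtain ⟨B, rfl⟩ := hX
  exact ⟨_, embed_conjTranspose Λ B⟩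

theorem ActsOn.mono {Λ Λ' : Finset V} (h : Λ ⊆ Λ') {X : Op V q} (hX : ActsOn Λ X) :
    ActsOn Λ' X := by
  obtain ⟨B, rfl⟩ := hX
  refine ⟨Matrix.of fun x y => if ∀ v : Λ', (v : V) ∉ Λ → x v = y v then
    B (fun v => x ⟨v, h v.2⟩) (fun v => y ⟨v, h v.2⟩) else 0, ?_⟩
  ext x y
  simp only [embed, Matrix.of_apply]
  rw [← ite_and]
  refine if_congr ⟨fun H => ⟨fun v hv => H v fun hv' => hv (h hv'), fun v hv => H v hv⟩,
    fun H v hv => ?_⟩ rfl rfl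
  by_cases hv' : v ∈ Λ'
  · exact H.2 ⟨v, hv'⟩ hv
  · exact H.1 v hv'

/-- Only one intermediate configuration contributes: it equals `x` off Λ and, Λ being disjoint from
Λ', equals `y` on Λ. The resulting formula is symmetric in the two factors, which gives
`ActsOn.commute`. -/
theorem embed_mul_embed_apply {Λ Λ' : Finset V} (h : Disjoint Λ Λ')
    (B : Matrix (Λ → Fin q) (Λ → Fin q) ℂ) (B' : Matrix (Λ' → Fin q) (Λ' → Fin q) ℂ)
    (x y : V → Fin q) :
    (embed Λ B * embed Λ' B') x y = if ∀ v, v ∉ Λ → v ∉ Λ' → x v = y v then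
      B (fun v => x v) (fun v => y v) * B' (fun v => x v) (fun v => y v) else 0 := by
  rw [Matrix.mul_apply, Finset.sum_eq_single (fun v => if v ∈ Λ then y v else x v)]
  · have h1 : ∀ v : V, v ∉ Λ → x v = if v ∈ Λ then y v else x v := fun v hv => by simp [hv]
    have h2 : (∀ v : V, v ∉ Λ' → (if v ∈ Λ then y v else x v) = y v) ↔
        ∀ v, v ∉ Λ → v ∉ Λ' → x v = y v := by
      refine ⟨fun H v hv hv' => by simpa [hv] using H v hv', fun H v hv' => ?_⟩
      split_ifs with hv
      · rfl
      · exact H v hv hv'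
    have h3 : (fun v : Λ => if (v : V) ∈ Λ then y v else x v) = fun v : Λ => y v := by
      ext v; simp
    have h4 : (fun v : Λ' => if (v : V) ∈ Λ then y v else x v) = fun v : Λ' => x v := by
      funext v
      exact if_neg (Finset.disjoint_right.1 h v.2)
    simp only [embed, Matrix.of_apply, if_pos h1, h2, h3, h4, mul_ite, mul_zero]
  · intro z _ hz
    simp only [embed, Matrix.of_apply]
    split_ifs with h1 h2
    · refine absurd (funext fun v => ?_) hz
      split_ifs with hv
      · exact h2 v (Finset.disjoint_left.1 h hv)
      · exact (h1 v hv).symm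
    all_goals simp
  · exact fun h => absurd (Finset.mem_univ _) h

theorem ActsOn.commute {Λ Λ' : Finset V} (h : Disjoint Λ Λ') {X Y : Op V q} (hX : ActsOn Λ X)
    (hY : ActsOn Λ' Y) : Commute X Y := by
  obtain ⟨B, rfl⟩ := hX
  obtain ⟨B', rfl⟩ := hY
  ext x y
  rw [embed_mul_embed_apply h, embed_mul_embed_apply h.symm]
  exact if_congr ⟨fun H v h1 h2 => H v h2 h1, fun H v h1 h2 => H v h2 h1⟩ (mul_comm _ _) rfl

theorem ActsOn.eq_smul_one {X : Op V q} (hX : ActsOn ∅ X) : ∃ c : ℂ, X = c • 1 := by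
  obtain ⟨B, rfl⟩ := hX
  refine ⟨B (fun v => absurd v.2 (Finset.notMem_empty _))
    (fun v => absurd v.2 (Finset.notMem_empty _)), ?_⟩
  ext x y
  simp only [embed, Matrix.of_apply, Matrix.smul_apply, Matrix.one_apply, funext_iff,
    Finset.notMem_empty, not_false_eq_true, forall_const, smul_eq_mul, mul_ite, mul_one, mul_zero]
  refine if_congr Iff.rfl ?_ rfl
  congr 1 <;> exact Subsingleton.elim _ _

/-- The operators acting only on `Λ`, as a submonoid. -/
def actsOnSubmonoid (q : ℕ) (Λ : Finset V) : Submonoid (Op V q) where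
  carrier := {X | ActsOn Λ X}
  one_mem' := actsOn_one Λ
  mul_mem' := ActsOn.mul

end ActsOn

/-! ### Ordered products in noncommutative rings -/

section ListProd

variable {R : Type*}

theorem prod_ofFn_eq_mul_of_commute [Monoid R] {r : ℕ} (F : Fin (r + 1) → R) (i : Fin (r + 1))
    (h : ∀ j, Commute (F i) (F j)) :
    (List.ofFn F).prod = F i * (List.ofFn fun j => F (i.succAbove j)).prod := by
  induction r with
  | zero => simp [Fin.fin_one_eq_zero i]
  | succ r ih =>
    induction i using Fin.cases with
    | zero => simp
    | succ i =>
      rw [List.ofFn_succ (f := F), List.prod_cons,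
        ih (fun j => F j.succ) i (fun j => h j.succ), ← mul_assoc, ← (h 0).eq, mul_assoc]
      congr 1
      rw [List.ofFn_succ, List.prod_cons]
      simp

theorem sum_pow_eq_sum_prod_ofFn [Semiring R] {ι : Type*} [Fintype ι] (g : ι → R) (r : ℕ) :
    (∑ a, g a) ^ r = ∑ f : Fin r → ι, (List.ofFn fun i => g (f i)).prod := by
  induction r with
  | zero => simp
  | succ r ih =>
    rw [pow_succ', ih, Finset.sum_mul_sum, ← Fintype.sum_prod_type']
    refine Fintype.sum_equiv (Fin.consEquiv fun _ => ι) _ _ fun f => ?_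
    simp [Fin.consEquiv, List.ofFn_succ]

theorem norm_prod_ofFn_le [NormedRing R] (h1 : ‖(1 : R)‖ ≤ 1) {r : ℕ} (F : Fin r → R)
    (w : Fin r → ℝ) (hw : ∀ i, ‖F i‖ ≤ w i) : ‖(List.ofFn F).prod‖ ≤ ∏ i, w i := by
  induction r with
  | zero => simpa using h1
  | succ r ih =>
    rw [List.ofFn_succ, List.prod_cons, Fin.prod_univ_succ]
    exact (norm_mul_le _ _).trans (mul_le_mul (hw 0) (ih _ _ fun i => hw i.succ)
      (norm_nonneg _) ((norm_nonneg _).trans (hw 0)))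

end ListProd

/-! ### States, expectations and Markov's inequality -/

section Expectation

variable {V : Type*} [Fintype V] [DecidableEq V] {q : ℕ}

theorem expect_add (ω X Y : Op V q) : expect ω (X + Y) = expect ω X + expect ω Y := by
  simp [expect, mul_add]

theorem expect_sub (ω X Y : Op V q) : expect ω (X - Y) = expect ω X - expect ω Y := by
  simp [expect, mul_sub]

theorem expect_smul (ω : Op V q) (c : ℂ) (X : Op V q) : expect ω (c • X) = c * expect ω X := by
  simp [expect]

theorem expect_sum (ω : Op V q) {ι : Type*} (s : Finset ι) (X : ι → Op V q) :
    expect ω (∑ i ∈ s, X i) = ∑ i ∈ s, expect ω (X i) := by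
  simp [expect, Finset.mul_sum, Matrix.trace_sum]

theorem IsState.expect_one {ω : Op V q} (hω : IsState ω) : expect ω 1 = 1 := by
  simpa [expect] using hω.2

theorem IsState.expect_conjTranspose {ω : Op V q} (hω : IsState ω) (X : Op V q) :
    expect ω X.conjTranspose = star (expect ω X) := by
  have h := hω.1.isHermitian.eq
  rw [expect, expect, ← Matrix.trace_conjTranspose, Matrix.conjTranspose_mul, h,
    Matrix.trace_mul_comm]

theorem IsState.expect_ofReal_re {ω : Op V q} (hω : IsState ω) {X : Op V q}
    (hX : X.IsHermitian) : (((expect ω X).re : ℝ) : ℂ) = expect ω X := by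
  have := hω.expect_conjTranspose X
  rw [hX.eq] at this
  exact Complex.conj_eq_iff_re.1 this.symm

/-- Equality fails when `q = 0` and V is nonempty: the matrix algebra is then the zero ring. -/
theorem norm_unitary_le {U : Op V q} (hU : U ∈ Matrix.unitaryGroup (V → Fin q) ℂ) : ‖U‖ ≤ 1 := by
  cases subsingleton_or_nontrivial (Op V q)
  · simp [Subsingleton.elim U 0]
  · exact (CStarRing.norm_of_mem_unitary hU).le

theorem norm_one_op_le : ‖(1 : Op V q)‖ ≤ 1 := norm_unitary_le (one_mem _)

theorem norm_entry_le (X : Op V q) (i j : V → Fin q) : ‖X i j‖ ≤ ‖X‖ := by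
  have h := Matrix.l2_opNorm_mulVec X (EuclideanSpace.single j 1)
  rw [PiLp.norm_single, norm_one, mul_one] at h
  refine le_trans ?_ ((PiLp.norm_apply_le _ i).trans h)
  simp

theorem expect_conj_diagonal (ω U : Op V q) (c : (V → Fin q) → ℂ) :
    expect ω (U * Matrix.diagonal c * star U) = ∑ i, (star U * ω * U) i i * c i := by
  rw [expect, ← mul_assoc, ← mul_assoc, Matrix.trace_mul_comm, ← mul_assoc, ← mul_assoc,
    Matrix.trace]
  simp [Matrix.mul_diagonal]

/-- In an eigenbasis of ω the expectation is a convex combination of diagonal entries of X, each at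
most the norm. -/
theorem IsState.norm_expect_le {ω : Op V q} (hω : IsState ω) (X : Op V q) :
    ‖expect ω X‖ ≤ ‖X‖ := by
  have hh := hω.1.isHermitian
  set U := (hh.eigenvectorUnitary : Op V q) with hU
  have hU1 : ‖U‖ ≤ 1 := norm_unitary_le hh.eigenvectorUnitary.2
  have hs : ω = U * Matrix.diagonal (fun i => (hh.eigenvalues i : ℂ)) * star U := by
    conv_lhs => rw [hh.spectral_theorem]
    rw [Unitary.conjStarAlgAut_apply]
    rfl
  have h1 : expect ω X = ∑ i, (star U * X * U) i i * (hh.eigenvalues i : ℂ) := by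
    rw [← expect_conj_diagonal, ← hs, expect, expect, Matrix.trace_mul_comm]
  have h2 : ∑ i, hh.eigenvalues i = 1 := by
    have := hh.trace_eq_sum_eigenvalues
    rw [hω.2] at this
    exact Complex.ofReal_injective (by simpa using this.symm)
  have h3 : ‖star U * X * U‖ ≤ ‖X‖ := by
    calc _ ≤ ‖star U‖ * ‖X‖ * ‖U‖ :=
          (norm_mul_le _ _).trans (mul_le_mul_of_nonneg_right (norm_mul_le _ _) (norm_nonneg _))
      _ ≤ 1 * ‖X‖ * 1 := by
        rw [norm_star]
        gcongr
      _ = ‖X‖ := by ring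
  calc ‖expect ω X‖ ≤ ∑ i, ‖(star U * X * U) i i * (hh.eigenvalues i : ℂ)‖ := by
        rw [h1]
        exact norm_sum_le _ _
    _ ≤ ∑ i, ‖X‖ * hh.eigenvalues i := by
        refine Finset.sum_le_sum fun i _ => ?_
        have h0 := hω.1.eigenvalues_nonneg i
        rw [norm_mul, Complex.norm_real, Real.norm_of_nonneg h0]
        exact mul_le_mul_of_nonneg_right ((norm_entry_le _ i i).trans h3) h0
    _ = ‖X‖ := by rw [← Finset.mul_sum, h2, mul_one]

/-- Markov's inequality for the exponential of an observable, through its moments. -/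
theorem IsState.probGE_le {ω : Op V q} (hω : IsState ω) {H : Op V q} (hH : H.IsHermitian)
    (m b : ℝ) {t B : ℝ} (ht : 0 ≤ t)
    (hB : ∀ R : ℕ, ∑ r ∈ Finset.range R,
      (expect ω ((H - (m : ℂ) • 1) ^ r)).re * t ^ r / r.factorial ≤ B) :
    probGE ω hH (m + b) ≤ Real.exp (-(t * b)) * B := by
  set U := (hH.eigenvectorUnitary : Op V q) with hU
  have hUU : star U * U = 1 := (Matrix.mem_unitaryGroup_iff'.1 hH.eigenvectorUnitary.2)
  have hUU' : U * star U = 1 := (Matrix.mem_unitaryGroup_iff.1 hH.eigenvectorUnitary.2)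
  set p : (V → Fin q) → ℝ := fun i => ((star U * ω * U) i i).re with hp
  have hps : (star U * ω * U).PosSemidef := hω.1.conjTranspose_mul_mul_same U
  have hp0 : ∀ i, 0 ≤ p i := fun i => (Complex.le_def.1 (hps.diag_nonneg (i := i))).1
  have hexp : ∀ c : (V → Fin q) → ℝ,
      (expect ω (U * Matrix.diagonal (fun i => (c i : ℂ)) * star U)).re = ∑ i, p i * c i := by
    intro c
    rw [expect_conj_diagonal, Complex.re_sum]
    simp [hp]
  have hs : H = U * Matrix.diagonal (fun i => (hH.eigenvalues i : ℂ)) * star U := by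
    conv_lhs => rw [hH.spectral_theorem]
    rw [Unitary.conjStarAlgAut_apply]
    rfl
  have hpow : ∀ r : ℕ, (H - (m : ℂ) • 1) ^ r =
      U * Matrix.diagonal (fun i => (((hH.eigenvalues i - m) ^ r : ℝ) : ℂ)) * star U := by
    intro r
    have h1 : H - (m : ℂ) • 1 =
        U * Matrix.diagonal (fun i => ((hH.eigenvalues i - m : ℝ) : ℂ)) * star U := by
      have : Matrix.diagonal (fun i => ((hH.eigenvalues i - m : ℝ) : ℂ)) =
          Matrix.diagonal (fun i => (hH.eigenvalues i : ℂ)) - (m : ℂ) • (1 : Op V q) := by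
        ext i j
        by_cases hij : i = j
        · subst hij; simp
        · simp [hij]
      rw [this, mul_sub, sub_mul, ← hs, mul_smul_comm, smul_mul_assoc, mul_one, hUU']
    induction r with
    | zero => simp [hUU']
    | succ r ih =>
      rw [pow_succ, ih, h1]
      calc _ = U * (Matrix.diagonal (fun i => (((hH.eigenvalues i - m) ^ r : ℝ) : ℂ)) *
            (star U * U) * Matrix.diagonal (fun i => ((hH.eigenvalues i - m : ℝ) : ℂ))) *
            star U := by simp only [mul_assoc]
        _ = _ := by
          rw [hUU, mul_one, Matrix.diagonal_mul_diagonal]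
          simp only [pow_succ, Complex.ofReal_mul]
  have hmom : ∀ r, (expect ω ((H - (m : ℂ) • 1) ^ r)).re =
      ∑ i, p i * (hH.eigenvalues i - m) ^ r := fun r => by rw [hpow, hexp]
  -- The partial sums converge to the exponential moment of the spectral distribution `p`, so the
  -- bound `B` passes to the limit.
  have hlim : Filter.Tendsto (fun R : ℕ => ∑ r ∈ Finset.range R,
      (expect ω ((H - (m : ℂ) • 1) ^ r)).re * t ^ r / r.factorial) Filter.atTop
      (nhds (∑ i, p i * Real.exp (t * (hH.eigenvalues i - m)))) := by
    have : ∀ R : ℕ, ∑ r ∈ Finset.range R,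
        (expect ω ((H - (m : ℂ) • 1) ^ r)).re * t ^ r / r.factorial =
        ∑ i, p i * ∑ r ∈ Finset.range R, (t * (hH.eigenvalues i - m)) ^ r / r.factorial := by
      intro R
      simp only [Finset.mul_sum]
      rw [Finset.sum_comm]
      refine Finset.sum_congr rfl fun r _ => ?_
      rw [hmom, Finset.sum_mul, Finset.sum_div]
      refine Finset.sum_congr rfl fun i _ => ?_
      rw [mul_pow]
      ring
    simp only [this]
    refine tendsto_finsetSum _ fun i _ => Filter.Tendsto.const_mul _ ?_
    rw [Real.exp_eq_exp_ℝ]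
    exact (NormedSpace.expSeries_div_hasSum_exp _).tendsto_sum_nat
  have hle := le_of_tendsto' hlim hB
  have hprob : probGE ω hH (m + b) =
      ∑ i, p i * if m + b ≤ hH.eigenvalues i then 1 else 0 := by
    rw [← hexp, probGE, spectralProj]
    simp only [apply_ite Complex.ofReal, Complex.ofReal_one, Complex.ofReal_zero]
    rfl
  rw [hprob]
  calc _ ≤ ∑ i, p i * (Real.exp (-(t * b)) * Real.exp (t * (hH.eigenvalues i - m))) := by
        refine Finset.sum_le_sum fun i _ => mul_le_mul_of_nonneg_left ?_ (hp0 i)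
        rw [← Real.exp_add]
        split_ifs with h
        · exact Real.one_le_exp (by nlinarith)
        · positivity
    _ = Real.exp (-(t * b)) * ∑ i, p i * Real.exp (t * (hH.eigenvalues i - m)) := by
        rw [Finset.mul_sum]
        exact Finset.sum_congr rfl fun i _ => by ring
    _ ≤ _ := mul_le_mul_of_nonneg_left hle (Real.exp_pos _).le

end Expectation

/-! ### Moments of sums of centred local terms -/

section Cluster

theorem le_regionDist {V : Type*} [MetricSpace V] {Λ₁ Λ₂ : Finset V} (h₁ : Λ₁.Nonempty) (h₂ : Λ₂.Nonempty) {l : ℝ}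
    (h : ∀ x ∈ Λ₁, ∀ y ∈ Λ₂, l ≤ dist x y) : l ≤ regionDist Λ₁ Λ₂ := by
  obtain ⟨x, hx⟩ := h₁
  obtain ⟨y, hy⟩ := h₂
  refine le_csInf ⟨_, x, hx, y, hy, rfl⟩ ?_
  rintro _ ⟨a, ha, b, hb, rfl⟩
  exact h a ha b hb

/-- The supports of the two terms come within distance `l` of each other. -/
def Near {V ι : Type*} [MetricSpace V] (supp : ι → Finset V) (l : ℝ) (a b : ι) : Prop :=
  ∃ x ∈ supp a, ∃ y ∈ supp b, dist x y ≤ l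

theorem Near.symm {V ι : Type*} [MetricSpace V] {supp : ι → Finset V} {l : ℝ} {a b : ι} (h : Near supp l a b) :
    Near supp l b a := by
  obtain ⟨x, hx, y, hy, hxy⟩ := h
  exact ⟨y, hy, x, hx, by rwa [dist_comm]⟩

theorem sum_mul_card_supp_le {V ι : Type*} [Fintype V] [DecidableEq V] [Fintype ι] {supp : ι → Finset V} {w : ι → ℝ}
    {L : ℝ} (hL : ∀ x : V, ∑ a with x ∈ supp a, w a ≤ L) :
    ∑ a, w a * (supp a).card ≤ Fintype.card V * L := by
  calc ∑ a, w a * (supp a).card = ∑ x : V, ∑ a with x ∈ supp a, w a := by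
        simp only [Finset.sum_filter]
        rw [Finset.sum_comm]
        refine Finset.sum_congr rfl fun a _ => ?_
        rw [← Finset.sum_filter, Finset.sum_const, nsmul_eq_mul, mul_comm]
        simp
    _ ≤ ∑ _x : V, L := Finset.sum_le_sum fun x _ => hL x
    _ = _ := by simp

variable {V : Type*} [Fintype V] [DecidableEq V] [MetricSpace V] {q : ℕ}

/-- A centred observable is almost uncorrelated with the distant operators it is multiplied by. -/
theorem re_expect_mul_le_of_far {ω : Op V q} (hω : IsState ω) {ξ C : ℝ} (hξ : 0 < ξ)
    (hC : 0 < C) (hcorr : HasCorrelationLength ω ξ C) {Λ₁ Λ₂ : Finset V} (h₁ : Λ₁.Nonempty)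
    (h₂ : Λ₂.Nonempty) {l : ℝ} (hl : 0 < l) (hfar : ∀ x ∈ Λ₁, ∀ y ∈ Λ₂, l ≤ dist x y)
    {g X : Op V q} (hg : g.IsHermitian) (hgΛ : ActsOn Λ₁ g) (hg0 : expect ω g = 0)
    (hX : ActsOn Λ₂ X) :
    (expect ω (g * X)).re ≤ C * Real.exp (-(l / ξ)) * (‖g‖ * ‖X‖) := by
  have hdisj : Disjoint Λ₁ Λ₂ := by
    rw [Finset.disjoint_left]
    intro x hx hx'
    have := hfar x hx x hx'
    rw [dist_self] at this
    exact absurd this (not_le.2 hl)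
  -- `X` need not be self-adjoint, so the correlation bound is applied to X + X†. As `g` commutes
  -- with X†, this has correlation 2 Re⟨gX⟩ with `g`; the 2 cancels against ‖X + X†‖ ≤ 2‖X‖.
  have hY : (X + X.conjTranspose).IsHermitian := Matrix.isHermitian_add_transpose_self X
  have hcomm : X.conjTranspose * g = g * X.conjTranspose :=
    (ActsOn.commute hdisj hgΛ hX.conjTranspose).eq.symm
  have h1 : expect ω (g * (X + X.conjTranspose)) = 2 * ((expect ω (g * X)).re : ℂ) := by
    have h2 : expect ω (g * X.conjTranspose) = star (expect ω (g * X)) := by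
      rw [← hω.expect_conjTranspose, Matrix.conjTranspose_mul, hg.eq, hcomm]
    rw [mul_add, expect_add, h2]
    exact Complex.add_conj _ |>.trans (by push_cast; rfl)
  have h3 := hcorr Λ₁ Λ₂ h₁ h₂ hdisj g _ hg hgΛ hY (hX.add hX.conjTranspose)
  rw [hg0, zero_mul, sub_zero, h1] at h3
  have h4 : ‖X + X.conjTranspose‖ ≤ 2 * ‖X‖ := by
    refine (norm_add_le _ _).trans ?_
    rw [Matrix.l2_opNorm_conjTranspose]
    linarith
  have h5 : Real.exp (-(regionDist Λ₁ Λ₂ / ξ)) ≤ Real.exp (-(l / ξ)) := by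
    have := le_regionDist h₁ h₂ hfar
    gcongr
  have h6 : 2 * (expect ω (g * X)).re ≤ ‖2 * ((expect ω (g * X)).re : ℂ)‖ := by
    rw [norm_mul, Complex.norm_real, Real.norm_eq_abs]
    simp [le_abs_self]
  have h7 : C * ‖g‖ * ‖X + X.conjTranspose‖ * Real.exp (-(regionDist Λ₁ Λ₂ / ξ)) ≤
      C * ‖g‖ * (2 * ‖X‖) * Real.exp (-(l / ξ)) := by gcongr
  linarith [h6.trans (h3.trans h7)]

variable {ι : Type*}

theorem re_expect_prod_ofFn_le {ω : Op V q} (hω : IsState ω) {ξ C : ℝ} (hξ : 0 < ξ)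
    (hC : 0 < C) (hcorr : HasCorrelationLength ω ξ C) {supp : ι → Finset V}
    (hsupp : ∀ a, (supp a).Nonempty) {g : ι → Op V q} (hg : ∀ a, (g a).IsHermitian)
    (hact : ∀ a, ActsOn (supp a) (g a)) (hg0 : ∀ a, expect ω (g a) = 0) {w : ι → ℝ}
    (hw : ∀ a, ‖g a‖ ≤ w a) {l : ℝ} (hl : 0 < l) {r : ℕ} (f : Fin r → ι)
    (hf : ¬ NoIsolated (Near supp l) f) :
    (expect ω (List.ofFn fun i => g (f i)).prod).re ≤
      C * Real.exp (-(l / ξ)) * ∏ i, w (f i) := by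
  have hw0 : ∀ a, 0 ≤ w a := fun a => (norm_nonneg _).trans (hw a)
  obtain ⟨i, hi⟩ : ∃ i, ∀ j, j ≠ i → ¬ Near supp l (f i) (f j) := by
    simpa [NoIsolated] using hf
  rcases r with _ | r
  · exact i.elim0
  have hfar : ∀ j, j ≠ i → ∀ x ∈ supp (f i), ∀ y ∈ supp (f j), l ≤ dist x y := by
    intro j hj x hx y hy
    by_contra hlt
    exact hi j hj ⟨x, hx, y, hy, (not_le.1 hlt).le⟩
  have hdisj : ∀ j, j ≠ i → Disjoint (supp (f i)) (supp (f j)) := by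
    intro j hj
    rw [Finset.disjoint_left]
    intro x hx hx'
    have := hfar j hj x hx x hx'
    rw [dist_self] at this
    exact absurd this (not_le.2 hl)
  have hcomm : ∀ j, Commute (g (f i)) (g (f j)) := by
    intro j
    rcases eq_or_ne j i with rfl | hj
    · exact Commute.refl _
    · exact ActsOn.commute (hdisj j hj) (hact _) (hact _)
  rw [prod_ofFn_eq_mul_of_commute (fun i => g (f i)) i hcomm]
  -- With a single factor the remaining region would be empty, outside the correlation hypothesis;
  -- there the expectation is zero by centring.
  rcases r with _ | r
  · have : 0 ≤ C * Real.exp (-(l / ξ)) * ∏ i, w (f i) := by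
      have := Finset.prod_nonneg fun (i : Fin (0 + 1)) (_ : i ∈ Finset.univ) => hw0 (f i)
      positivity
    simpa [hg0] using this
  set U : Finset V := Finset.univ.biUnion fun j : Fin (r + 1) => supp (f (i.succAbove j)) with hU
  have hX : ActsOn U (List.ofFn fun j => g (f (i.succAbove j))).prod := by
    refine (actsOnSubmonoid q U).list_prod_mem fun Y hY => ?_
    obtain ⟨j, rfl⟩ := (List.mem_ofFn' _ _).1 hY
    exact (hact _).mono (Finset.subset_biUnion_of_mem
      (fun j : Fin (r + 1) => supp (f (i.succAbove j))) (Finset.mem_univ j))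
  have hUn : U.Nonempty := by
    obtain ⟨y, hy⟩ := hsupp (f (i.succAbove 0))
    exact ⟨y, Finset.mem_biUnion.2 ⟨0, Finset.mem_univ _, hy⟩⟩
  refine (re_expect_mul_le_of_far hω hξ hC hcorr (hsupp (f i)) hUn hl ?_ (hg _) (hact _)
    (hg0 _) hX).trans ?_
  · intro x hx y hy
    obtain ⟨j, -, hy⟩ := Finset.mem_biUnion.1 hy
    exact hfar _ (Fin.succAbove_ne i j) x hx y hy
  · rw [Fin.prod_univ_succAbove _ i]
    have h1 := hw (f i)
    have h2 := norm_prod_ofFn_le norm_one_op_le (fun j => g (f (i.succAbove j)))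
      (fun j => w (f (i.succAbove j))) fun j => hw _
    have h3 := hw0 (f i)
    gcongr

/-- The error of the families with an isolated label is extended to all families, where it sums to a
pure power. -/
theorem re_expect_sum_pow_le [Fintype ι] {ω : Op V q} (hω : IsState ω) {ξ C : ℝ} (hξ : 0 < ξ)
    (hC : 0 < C) (hcorr : HasCorrelationLength ω ξ C) {supp : ι → Finset V}
    (hsupp : ∀ a, (supp a).Nonempty) {g : ι → Op V q} (hg : ∀ a, (g a).IsHermitian)
    (hact : ∀ a, ActsOn (supp a) (g a)) (hg0 : ∀ a, expect ω (g a) = 0) {w : ι → ℝ}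
    (hw : ∀ a, ‖g a‖ ≤ w a) {l : ℝ} (hl : 0 < l) (r : ℕ) :
    (expect ω ((∑ a, g a) ^ r)).re ≤
      clusterWeight (Fin r) (Near supp l) w + C * Real.exp (-(l / ξ)) * (∑ a, w a) ^ r := by
  classical
  have hw0 : ∀ a, 0 ≤ w a := fun a => (norm_nonneg _).trans (hw a)
  rw [sum_pow_eq_sum_prod_ofFn, expect_sum, Complex.re_sum, clusterWeight, Fintype.sum_pow,
    Finset.mul_sum, ← Finset.sum_add_distrib]
  refine Finset.sum_le_sum fun f _ => ?_
  have hp : 0 ≤ ∏ i, w (f i) := Finset.prod_nonneg fun i _ => hw0 _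
  by_cases hf : NoIsolated (Near supp l) f
  · rw [if_pos hf]
    have h1 : (expect ω (List.ofFn fun i => g (f i)).prod).re ≤ ∏ i, w (f i) :=
      (Complex.re_le_norm _).trans ((hω.norm_expect_le _).trans
        (norm_prod_ofFn_le norm_one_op_le _ (fun i => w (f i)) fun i => hw _))
    have : 0 ≤ C * Real.exp (-(l / ξ)) * ∏ i, w (f i) := by positivity
    linarith
  · rw [if_neg hf, zero_add]
    exact re_expect_prod_ofFn_le hω hξ hC hcorr hsupp hg hact hg0 hw hl f hf

/-- The weight of the terms near a given one. -/
theorem sum_near_le [Fintype ι] {supp : ι → Finset V} {w : ι → ℝ} (hw : ∀ a, 0 ≤ w a)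
    {l L M : ℝ} (hM : ∀ x : V, ((Metric.closedBall x l).ncard : ℝ) ≤ M)
    (hL0 : 0 ≤ L) (hL : ∀ x : V, ∑ a with x ∈ supp a, w a ≤ L) (c : ι)
    [DecidablePred (Near supp l c)] :
    ∑ b with Near supp l c b, w b ≤ (supp c).card * (M * L) := by
  classical
  have h1 : ∀ x : V, ∑ y with dist x y ≤ l, ∑ b with y ∈ supp b, w b ≤ M * L := by
    intro x
    refine (Finset.sum_le_card_nsmul _ _ L fun y _ => hL y).trans ?_
    rw [nsmul_eq_mul]
    refine mul_le_mul_of_nonneg_right ?_ hL0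
    refine le_trans (le_of_eq ?_) (hM x)
    rw [← Set.ncard_coe_finset]
    congr 2
    ext y
    simp [dist_comm]
  calc _ ≤ ∑ b, ∑ x ∈ supp c, ∑ y with dist x y ≤ l, if y ∈ supp b then w b else 0 := by
        rw [Finset.sum_filter]
        refine Finset.sum_le_sum fun b _ => ?_
        have h0 : ∀ y, 0 ≤ if y ∈ supp b then w b else 0 := fun y => by
          split_ifs <;> simp [hw]
        split_ifs with h
        · obtain ⟨x, hx, y, hy, hxy⟩ := h
          calc w b = if y ∈ supp b then w b else 0 := (if_pos hy).symm
            _ ≤ ∑ y with dist x y ≤ l, if y ∈ supp b then w b else 0 :=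
              Finset.single_le_sum (f := fun y => if y ∈ supp b then w b else 0)
                (fun y _ => h0 y) (by simpa using hxy)
            _ ≤ _ := Finset.single_le_sum
                (f := fun x => ∑ y with dist x y ≤ l, if y ∈ supp b then w b else 0)
                (fun x _ => Finset.sum_nonneg fun y _ => h0 y) hx
        · exact Finset.sum_nonneg fun x _ => Finset.sum_nonneg fun y _ => h0 y
    _ = ∑ x ∈ supp c, ∑ y with dist x y ≤ l, ∑ b with y ∈ supp b, w b := by
        rw [Finset.sum_comm]
        refine Finset.sum_congr rfl fun x _ => ?_
        rw [Finset.sum_comm]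
        refine Finset.sum_congr rfl fun y _ => ?_
        rw [Finset.sum_filter]
    _ ≤ _ := by
        refine (Finset.sum_le_card_nsmul _ _ (M * L) fun x _ => h1 x).trans ?_
        rw [nsmul_eq_mul]

theorem sum_re_expect_pow_le [Fintype ι] {ω : Op V q} (hω : IsState ω) {ξ C : ℝ} (hξ : 0 < ξ)
    (hC : 0 < C) (hcorr : HasCorrelationLength ω ξ C) {supp : ι → Finset V}
    (hsupp : ∀ a, (supp a).Nonempty) {k : ℕ} (hk : 0 < k) (hcard : ∀ a, (supp a).card ≤ k)
    {g : ι → Op V q} (hg : ∀ a, (g a).IsHermitian)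
    (hact : ∀ a, ActsOn (supp a) (g a)) (hg0 : ∀ a, expect ω (g a) = 0) {w : ι → ℝ}
    (hw : ∀ a, ‖g a‖ ≤ w a) {l L M : ℝ} (hl : 0 < l) (hM0 : 0 < M)
    (hM : ∀ x : V, ((Metric.closedBall x l).ncard : ℝ) ≤ M)
    (hL0 : 0 < L) (hL : ∀ x : V, ∑ a with x ∈ supp a, w a ≤ L) {t : ℝ} (ht : 0 ≤ t) (R : ℕ) :
    ∑ r ∈ Finset.range R, (expect ω ((∑ a, g a) ^ r)).re * t ^ r / r.factorial ≤
      Real.exp (Fintype.card V / (k ^ 2 * M) * cumulantBound (t * (k * M * L))) +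
        C * Real.exp (-(l / ξ) + t * (Fintype.card V * L)) := by
  classical
  have hw0 : ∀ a, 0 ≤ w a := fun a => (norm_nonneg _).trans (hw a)
  have hkR : (0 : ℝ) < k := by exact_mod_cast hk
  have hW := sum_mul_card_supp_le hL
  have hW1 : ∑ a, w a ≤ Fintype.card V * L := by
    refine (Finset.sum_le_sum fun a _ => ?_).trans hW
    have : (1 : ℝ) ≤ (supp a).card := by exact_mod_cast (hsupp a).card_pos
    exact le_mul_of_one_le_right (hw0 a) this
  -- A term c has neighbours of weight at most |supp c| M L = θ K, and Σ w |supp| ≤ nL gives Σ w θ ≤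
  -- nL/k = W.
  have h1 := sum_clusterWeight_le (adj := Near supp l) (fun a b h => h.symm) hw0
    (K := k * M * L) (W := Fintype.card V * L / k) (by positivity)
    (θ := fun a => (supp a).card / k) (fun a => by positivity)
    (fun a => by
      rw [div_le_one hkR]
      exact_mod_cast hcard a)
    (fun c => by
      refine (sum_near_le hw0 hM hL0.le hL c).trans (le_of_eq ?_)
      field_simp)
    (by
      rw [le_div_iff₀ hkR, Finset.sum_mul]
      refine le_trans (le_of_eq ?_) hW
      refine Finset.sum_congr rfl fun a _ => ?_
      field_simp) ht R
  have h2 : (Fintype.card V * L / k / (k * M * L) : ℝ) = Fintype.card V / (k ^ 2 * M) := by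
    field_simp
  rw [h2] at h1
  have hW0 : 0 ≤ ∑ a, w a := Finset.sum_nonneg fun a _ => hw0 a
  have h3 : ∑ r ∈ Finset.range R, (∑ a, w a) ^ r * t ^ r / r.factorial ≤
      Real.exp (t * (Fintype.card V * L)) := by
    refine le_trans ?_ ((Real.sum_le_exp_of_nonneg (mul_nonneg ht hW0) R).trans ?_)
    · exact le_of_eq (Finset.sum_congr rfl fun r _ => by rw [mul_pow, mul_comm (t ^ r)])
    · gcongr
  calc _ ≤ ∑ r ∈ Finset.range R, (clusterWeight (Fin r) (Near supp l) w +
        C * Real.exp (-(l / ξ)) * (∑ a, w a) ^ r) * t ^ r / r.factorial := by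
        refine Finset.sum_le_sum fun r _ => ?_
        have := re_expect_sum_pow_le hω hξ hC hcorr hsupp hg hact hg0 hw hl r
        gcongr
    _ = ∑ r ∈ Finset.range R, clusterWeight (Fin r) (Near supp l) w * t ^ r / r.factorial +
        C * Real.exp (-(l / ξ)) *
          ∑ r ∈ Finset.range R, (∑ a, w a) ^ r * t ^ r / r.factorial := by
        rw [Finset.mul_sum, ← Finset.sum_add_distrib]
        exact Finset.sum_congr rfl fun r _ => by ring
    _ ≤ _ := by
        rw [Real.exp_add, ← mul_assoc C]
        exact add_le_add h1 (mul_le_mul_of_nonneg_left h3 (by positivity))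

end Cluster

/-! ### From moments to tail bounds -/

section Concentration

theorem localNorm_zero {V : Type*} [Fintype V] [DecidableEq V] {q : ℕ} (H : Op V q) :
    localNorm 0 H = 0 := by
  have h0 : ∀ h : Finset V → Op V q, dependence 0 h = 0 := by
    intro h
    have : ∀ x : V, ∑ Λ with x ∈ Λ ∧ Λ.card ≤ 0, ‖h Λ‖ = 0 := by
      intro x
      refine Finset.sum_eq_zero fun Λ hΛ => ?_
      simp only [Finset.mem_filter, Finset.mem_univ, true_and, Nat.le_zero,
        Finset.card_eq_zero] at hΛ
      obtain ⟨hx, rfl⟩ := hΛ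
      simp at hx
    simp only [dependence, this, Real.iSup_const_zero, mul_zero]
  refine le_antisymm (Real.sInf_nonpos ?_) (Real.sInf_nonneg ?_) <;>
  · rintro _ ⟨h, -, rfl⟩
    simp [h0]

theorem localNorm_of_isEmpty {V : Type*} [Fintype V] [DecidableEq V] [IsEmpty V] {q : ℕ} (k : ℕ)
    (H : Op V q) : localNorm k H = 0 := by
  refine le_antisymm (Real.sInf_nonpos ?_) (Real.sInf_nonneg ?_) <;>
  · rintro _ ⟨h, -, rfl⟩
    simp [dependence]

theorem exists_isDecomposition_lt {V : Type*} [Fintype V] [DecidableEq V] {q k : ℕ} {H : Op V q}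
    (h0 : 0 < localNorm k H) {L : ℝ} (hL : localNorm k H < L) :
    ∃ h, IsDecomposition k H h ∧ dependence k h < L := by
  have hne : {b | ∃ h : Finset V → Op V q, IsDecomposition k H h ∧ b = dependence k h}.Nonempty := by
    by_contra hne
    rw [localNorm, Set.not_nonempty_iff_eq_empty.1 hne, Real.sInf_empty] at h0
    exact lt_irrefl _ h0
  obtain ⟨_, ⟨h, hh, rfl⟩, hlt⟩ := exists_lt_of_csInf_lt hne hL
  exact ⟨h, hh, hlt⟩

variable {V : Type*} [Fintype V] [DecidableEq V] [MetricSpace V] {q : ℕ}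

theorem probGE_le_of_isDecomposition {ω : Op V q} (hω : IsState ω) {ξ C : ℝ} (hξ : 0 < ξ)
    (hC : 0 < C) (hcorr : HasCorrelationLength ω ξ C) {k : ℕ} (hk : 0 < k) {H : Op V q}
    (hH : H.IsHermitian) {h : Finset V → Op V q} (hdec : IsDecomposition k H h) {l L M : ℝ}
    (hl : 0 < l) (hM0 : 0 < M) (hM : ∀ x : V, ((Metric.closedBall x l).ncard : ℝ) ≤ M)
    (hL0 : 0 < L) (hL : dependence k h ≤ L) {t : ℝ} (ht : 0 ≤ t) (b : ℝ) :
    probGE ω hH ((expect ω H).re + b) ≤ Real.exp (-(t * b)) *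
      (Real.exp (Fintype.card V / (k ^ 2 * M) * cumulantBound (t * (k * M * L))) +
        C * Real.exp (-(l / ξ) + t * (Fintype.card V * L))) := by
  set g : Finset V → Op V q := fun Λ => h Λ - expect ω (h Λ) • (1 : Op V q) with hg
  have hg0 : ∀ Λ, expect ω (g Λ) = 0 := fun Λ => by
    rw [hg]
    simp only [expect_sub, expect_smul, hω.expect_one, mul_one, sub_self]
  have hgh : ∀ Λ, (g Λ).IsHermitian := fun Λ => by
    refine (hdec.isHermitian Λ).sub ?_
    rw [← hω.expect_ofReal_re (hdec.isHermitian Λ), Matrix.IsHermitian, Matrix.conjTranspose_smul,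
      Matrix.conjTranspose_one]
    simp
  have hga : ∀ Λ, ActsOn Λ (g Λ) := fun Λ => by
    have := (hdec.actsOn Λ).add ((actsOn_one Λ).smul (-expect ω (h Λ)))
    rwa [neg_smul, ← sub_eq_add_neg] at this
  -- Centring costs the factor 2 that is built into `dependence`.
  have hgn : ∀ Λ, ‖g Λ‖ ≤ 2 * ‖h Λ‖ := fun Λ => by
    have h1 : ‖expect ω (h Λ) • (1 : Op V q)‖ ≤ ‖h Λ‖ * 1 := by
      rw [norm_smul]
      exact mul_le_mul (hω.norm_expect_le _) norm_one_op_le (norm_nonneg _) (norm_nonneg _)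
    have := norm_sub_le (h Λ) (expect ω (h Λ) • (1 : Op V q))
    simp only [hg]
    linarith
  -- A centred scalar vanishes, so all remaining supports are nonempty, as the correlation
  -- hypothesis requires.
  have hge : g ∅ = 0 := by
    obtain ⟨c, hc⟩ := (hga ∅).eq_smul_one
    have := hg0 ∅
    rw [hc, expect_smul, hω.expect_one, mul_one] at this
    rw [hc, this, zero_smul]
  have hsum : H - ((expect ω H).re : ℂ) • 1 =
      ∑ a : {Λ : Finset V // Λ.Nonempty ∧ Λ.card ≤ k}, g a := by
    have h1 : H - ((expect ω H).re : ℂ) • 1 = ∑ Λ with Λ.card ≤ k, g Λ := by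
      rw [hω.expect_ofReal_re hH, hg, Finset.sum_sub_distrib, ← Finset.sum_smul, ← expect_sum,
        ← hdec.sum_eq]
    rw [h1, ← Finset.sum_subtype (Finset.univ.filter fun Λ : Finset V =>
      Λ.Nonempty ∧ Λ.card ≤ k) (by simp) g]
    symm
    refine Finset.sum_subset (fun Λ hΛ => ?_) fun Λ hΛ hΛ' => ?_
    · simp only [Finset.mem_filter, Finset.mem_univ, true_and] at hΛ ⊢
      exact hΛ.2
    · simp only [Finset.mem_filter, Finset.mem_univ, true_and] at hΛ hΛ'
      rcases Λ.eq_empty_or_nonempty with rfl | hne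
      · exact hge
      · exact absurd ⟨hne, hΛ⟩ hΛ'
  refine hω.probGE_le hH _ b ht fun R => ?_
  rw [hsum]
  refine sum_re_expect_pow_le hω hξ hC hcorr
    (supp := fun a : {Λ : Finset V // Λ.Nonempty ∧ Λ.card ≤ k} => a.1) (fun a => a.2.1) hk
    (fun a => a.2.2) (fun a => hgh a) (fun a => hga a) (fun a => hg0 a)
    (w := fun a => 2 * ‖h a‖) (fun a => hgn a) hl hM0 hM hL0 (fun x => ?_) ht R
  refine le_trans ?_ hL
  rw [dependence]
  have h2 := le_ciSup (f := fun x : V => ∑ Λ with x ∈ Λ ∧ Λ.card ≤ k, ‖h Λ‖)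
    (Set.finite_range _).bddAbove x
  refine le_trans (le_of_eq ?_) (mul_le_mul_of_nonneg_left h2 zero_le_two)
  rw [Finset.mul_sum, Finset.sum_filter,
    ← Finset.sum_subtype (Finset.univ.filter fun Λ : Finset V => Λ.Nonempty ∧ Λ.card ≤ k)
      (by simp) (fun Λ => if x ∈ Λ then 2 * ‖h Λ‖ else 0), ← Finset.sum_filter,
    Finset.filter_filter]
  refine Finset.sum_congr (Finset.filter_congr fun Λ _ => ?_) fun _ _ => rfl
  exact ⟨fun H => ⟨H.2, H.1.2⟩, fun H => ⟨⟨⟨x, H.1⟩, H.2⟩, H.1⟩⟩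

/-- The infimum need not be shown to be attained: the bound is continuous in L, and L decreases to
the local norm. -/
theorem probGE_le_of_localNorm {ω : Op V q} (hω : IsState ω) {ξ C : ℝ} (hξ : 0 < ξ)
    (hC : 0 < C) (hcorr : HasCorrelationLength ω ξ C) {k : ℕ} (hk : 0 < k) {H : Op V q}
    (hH : H.IsHermitian) (hloc : 0 < localNorm k H) {l M : ℝ}
    (hl : 0 < l) (hM0 : 0 < M) (hM : ∀ x : V, ((Metric.closedBall x l).ncard : ℝ) ≤ M)
    {t : ℝ} (ht : 0 ≤ t) (b : ℝ) :
    probGE ω hH ((expect ω H).re + b) ≤ Real.exp (-(t * b)) *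
      (Real.exp (Fintype.card V / (k ^ 2 * M) * cumulantBound (t * (k * M * localNorm k H))) +
        C * Real.exp (-(l / ξ) + t * (Fintype.card V * localNorm k H))) := by
  have hcont : Continuous fun L : ℝ => Real.exp (-(t * b)) *
      (Real.exp (Fintype.card V / (k ^ 2 * M) * cumulantBound (t * (k * M * L))) +
        C * Real.exp (-(l / ξ) + t * (Fintype.card V * L))) := by
    unfold cumulantBound
    fun_prop
  refine ge_of_tendsto (hcont.continuousWithinAt (s := Set.Ioi (localNorm k H))) ?_
  filter_upwards [self_mem_nhdsWithin] with L hL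
  obtain ⟨h, hh, hlt⟩ := exists_isDecomposition_lt hloc hL
  exact probGE_le_of_isDecomposition hω hξ hC hcorr hk hH hh hl hM0 hM (hloc.trans hL) hlt.le ht b

theorem rateF_pos {x : ℝ} (hx : 0 < x) : 0 < rateF x := by
  -- At s = log(1 + x) the term x - e^s + 1 vanishes and the value s²/2 remains.
  have hs : 0 < Real.log (1 + x) := Real.log_pos (by linarith)
  have h := (isMaxOn_sStar hx).2 (Set.mem_Ioi.2 hs)
  rw [rateF_eq hx]
  refine lt_of_lt_of_le ?_ h
  rw [rateAux, Real.exp_log (by linarith)]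
  nlinarith

/-- The cumulant bound is superlinear. -/
theorem cumulantBound_div_le {s M : ℝ} (hs : 0 ≤ s) (hM : 1 ≤ M) :
    cumulantBound (s / M) ≤ cumulantBound s / M := by
  have hM0 : 0 < M := by linarith
  have hsM : s / M ≤ s := div_le_self hs hM
  have h0 : 0 ≤ s / M := by positivity
  -- This makes e^s - s/2 at least its value at s/M.
  have h1 : Real.exp (s / M) * (1 + (s - s / M)) ≤ Real.exp s := by
    have := Real.add_one_le_exp (s - s / M)
    calc _ ≤ Real.exp (s / M) * Real.exp (s - s / M) := by
          gcongr
          linarith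
      _ = Real.exp s := by rw [← Real.exp_add]; congr 1; ring
  have h2 : Real.exp (s / M) - 1 - s / M / 2 ≤ Real.exp s - 1 - s / 2 := by
    have := Real.one_le_exp h0
    nlinarith
  calc cumulantBound (s / M) ≤ s / M * (Real.exp s - 1 - s / 2) :=
        mul_le_mul_of_nonneg_left h2 h0
    _ = _ := by rw [cumulantBound]; ring

/-- Concentration at a length scale `l` with balls of at most `M` spins. -/
theorem probGE_le_of_scale {ω : Op V q} (hω : IsState ω) {ξ C : ℝ} (hξ : 0 < ξ)
    (hC : 0 < C) (hcorr : HasCorrelationLength ω ξ C) {k : ℕ} (hk : 0 < k) {H : Op V q}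
    (hH : H.IsHermitian) (hloc : 0 < localNorm k H) {l M : ℝ}
    (hl : 0 < l) (hM1 : 1 ≤ M) (hM : ∀ x : V, ((Metric.closedBall x l).ncard : ℝ) ≤ M)
    {a x : ℝ} (ha : 0 < a) (hx : x = a * k / localNorm k H)
    (hlM : Fintype.card V / (k * M ^ 2) * (k * sStar x + rateF x) ≤ l / ξ) :
    probGE ω hH ((expect ω H).re + Fintype.card V * a) ≤
      (C + 1) * Real.exp (-(Fintype.card V * (rateF x / (k ^ 2 * M ^ 2)))) := by
  set n : ℝ := (Fintype.card V : ℝ) with hn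
  have hn0 : 0 ≤ n := Nat.cast_nonneg _
  set L := localNorm k H with hLdef
  have hkR : (1 : ℝ) ≤ k := by exact_mod_cast hk
  have hk0 : (0 : ℝ) < k := by linarith
  have hM0 : 0 < M := by linarith
  have hx0 : 0 < x := by rw [hx]; positivity
  set s := sStar x with hs
  have hs0 : 0 < s := (sStar_spec hx0).1
  have hF0 := rateF_pos hx0
  have hF : rateF x = s * x - cumulantBound s := by
    rw [rateF_eq hx0, rateAux, cumulantBound]
    ring
  -- The M² in t, rather than M, keeps the error growth tnL at ns/(kM²), to be beaten by l/ξ;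
  -- `cumulantBound_div_le` then supplies the matching 1/M² in the cluster part.
  have hmain := probGE_le_of_localNorm hω hξ hC hcorr hk hH hloc hl hM0 hM
    (t := s / (k * M ^ 2 * L)) (by positivity) (n * a)
  have h1 : s / (k * M ^ 2 * L) * (n * a) = n / (k ^ 2 * M ^ 2) * (s * x) := by
    rw [hx]
    field_simp
  have h2 : s / (k * M ^ 2 * L) * (k * M * L) = s / M := by
    field_simp
  have h3 : s / (k * M ^ 2 * L) * (n * L) = n / (k * M ^ 2) * s := by
    field_simp
  rw [← hLdef, ← hn, h1, h2, h3] at hmain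
  refine hmain.trans ?_
  rw [mul_add, add_comm C 1, add_mul, one_mul]
  have h4 : n * (rateF x / (k ^ 2 * M ^ 2)) = n / (k ^ 2 * M ^ 2) * rateF x := by ring
  rw [h4]
  refine add_le_add ?_ ?_
  · rw [← Real.exp_add, Real.exp_le_exp]
    have h5 := cumulantBound_div_le hs0.le hM1
    have h6 : n / (k ^ 2 * M) * cumulantBound (s / M) ≤
        n / (k ^ 2 * M ^ 2) * cumulantBound s := by
      calc _ ≤ n / (k ^ 2 * M) * (cumulantBound s / M) := by gcongr
        _ = _ := by field_simp
    rw [hF, mul_sub]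
    linarith
  · rw [mul_left_comm, ← Real.exp_add]
    refine mul_le_mul_of_nonneg_left (Real.exp_le_exp.2 ?_) hC.le
    -- For the error part the Markov factor is simply dropped.
    have h5 : 0 ≤ n / (k ^ 2 * M ^ 2) * (s * x) := by positivity
    have h6 : n / (k * M ^ 2) * s ≤ n / (k * M ^ 2) * (k * s) := by
      gcongr
      exact le_mul_of_one_le_left hs0.le hkR
    have h7 : n / (k ^ 2 * M ^ 2) * rateF x ≤ n / (k * M ^ 2) * rateF x := by
      gcongr
      exact le_self_pow₀ hkR two_ne_zero
    rw [mul_add] at hlM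
    linarith

end Concentration

end SpinSystem

/-! ### Choice of the length scale -/

open SpinSystem in
theorem mainTheorem2 {V : Type*} [Fintype V] [DecidableEq V] [MetricSpace V] {q : ℕ}
    (n : ℕ) (hn : n = Fintype.card V)
    (A d r₀ : ℝ) (hA : 0 < A) (hd : 1 ≤ d) (hr₀ : 0 < r₀) (hball : BallGrowth V A d r₀)
    (ω : Op V q) (hω : IsState ω)
    (ξ C : ℝ) (hξ : 0 < ξ) (hC : 0 < C) (hcorr : HasCorrelationLength ω ξ C)
    (k : ℕ) (H : Op V q) (hH : H.IsHermitian) (hk : IsKLocal k H) (hloc : 0 < localNorm k H)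
    (a : ℝ) (ha : 0 < a) (x D : ℝ) (hx : x = a * k / localNorm k H)
    (hD : D = ξ / (k * A ^ 2) * (k * sStar x + rateF x)) :
    (r₀ ≤ (n * D) ^ (1 / (2 * d + 1)) →
      probGE ω hH ((expect ω H).re + n * a) ≤
        (C + 1) * Real.exp (-((n : ℝ) ^ (1 / (2 * d + 1)) *
          (rateF x / ((k : ℝ) ^ 2 * A ^ 2 * D ^ (2 * d / (2 * d + 1))))))) ∧
    ((n * D) ^ (1 / (2 * d + 1)) < r₀ →
      probGE ω hH ((expect ω H).re + n * a) ≤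
        (C + 1) * Real.exp (-(n * (rateF x / ((k : ℝ) ^ 2 * A ^ 2 * r₀ ^ (2 * d)))))) := by
  -- Positivity of the local norm rules out k = 0 and an empty system.
  have hk0 : 0 < k := by
    rcases Nat.eq_zero_or_pos k with rfl | h
    · rw [localNorm_zero] at hloc
      exact absurd hloc (lt_irrefl _)
    · exact h
  have hV : Nonempty V := by
    by_contra hV
    rw [not_nonempty_iff] at hV
    rw [localNorm_of_isEmpty] at hloc
    exact lt_irrefl _ hloc
  have hn0 : (0 : ℝ) < n := by
    rw [hn]
    exact_mod_cast Fintype.card_pos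
  have hkR : (0 : ℝ) < k := by exact_mod_cast hk0
  have hx0 : 0 < x := by rw [hx]; positivity
  have hs0 : 0 < sStar x := (sStar_spec hx0).1
  have hF0 := rateF_pos hx0
  have hD0 : 0 < D := by rw [hD]; positivity
  have he : 0 < 2 * d + 1 := by linarith
  -- Both cases at once: with M = A l^d, the condition of `probGE_le_of_scale` becomes nD ≤
  -- l^(2d+1). A ball contains its centre, so M ≥ 1.
  have key : ∀ l : ℝ, r₀ ≤ l → n * D ≤ l ^ (2 * d + 1) →
      probGE ω hH ((expect ω H).re + n * a) ≤
        (C + 1) * Real.exp (-(n * (rateF x / ((k : ℝ) ^ 2 * A ^ 2 * l ^ (2 * d))))) := by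
    intro l hl hlD
    have hl0 : 0 < l := hr₀.trans_le hl
    have hM : ∀ v : V, ((Metric.closedBall v l).ncard : ℝ) ≤ A * l ^ d := fun v => hball v l hl
    have hM1 : 1 ≤ A * l ^ d := by
      obtain ⟨v⟩ := hV
      refine le_trans ?_ (hM v)
      have : 0 < (Metric.closedBall v l).ncard :=
        (Set.ncard_pos (Set.toFinite _)).2 ⟨v, Metric.mem_closedBall_self hl0.le⟩
      exact_mod_cast this
    have hM2 : (A * l ^ d) ^ 2 = A ^ 2 * l ^ (2 * d) := by
      rw [mul_pow, ← Real.rpow_natCast (l ^ d), ← Real.rpow_mul hl0.le]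
      congr 2
      push_cast
      ring
    have hl2 : 0 < l ^ (2 * d) := Real.rpow_pos_of_pos hl0 _
    have hmain := probGE_le_of_scale hω hξ hC hcorr hk0 hH hloc hl0 hM1 hM ha hx (by
      rw [← hn, hM2, le_div_iff₀ hξ]
      have h1 : n / (k * (A ^ 2 * l ^ (2 * d))) * (k * sStar x + rateF x) * ξ =
          n * D / l ^ (2 * d) := by
        rw [hD]
        field_simp
      rw [h1, div_le_iff₀ hl2]
      rwa [Real.rpow_add hl0, Real.rpow_one, mul_comm (l ^ (2 * d))] at hlD)
    rwa [← hn, hM2, ← mul_assoc ((k : ℝ) ^ 2)] at hmain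
  have hnD : 0 < n * D := by positivity
  constructor
  · intro hl
    refine (key _ hl ?_).trans (le_of_eq ?_)
    · rw [← Real.rpow_mul hnD.le, one_div_mul_cancel he.ne', Real.rpow_one]
    · have h1 : ((n * D) ^ (1 / (2 * d + 1))) ^ (2 * d) =
          (n : ℝ) ^ (2 * d / (2 * d + 1)) * D ^ (2 * d / (2 * d + 1)) := by
        rw [← Real.rpow_mul hnD.le, one_div_mul_eq_div, Real.mul_rpow hn0.le hD0.le]
      have h2 : (n : ℝ) = n ^ (1 / (2 * d + 1)) * n ^ (2 * d / (2 * d + 1)) := by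
        rw [← Real.rpow_add hn0]
        have : 1 / (2 * d + 1) + 2 * d / (2 * d + 1) = 1 := by
          field_simp
          ring
        rw [this, Real.rpow_one]
      have h3 : 0 < (n : ℝ) ^ (2 * d / (2 * d + 1)) := Real.rpow_pos_of_pos hn0 _
      have h4 : 0 < D ^ (2 * d / (2 * d + 1)) := Real.rpow_pos_of_pos hD0 _
      rw [h1]
      congr 3
      rw [mul_div_assoc', mul_div_assoc', div_eq_div_iff (by positivity) (by positivity)]
      linear_combination
        (rateF x * (k ^ 2 * A ^ 2 * D ^ (2 * d / (2 * d + 1)))) * h2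
  · intro hl
    refine key r₀ le_rfl ?_
    have h1 := Real.rpow_le_rpow (by positivity) hl.le he.le
    rwa [← Real.rpow_mul hnD.le, one_div_mul_cancel he.ne', Real.rpow_one] at h1

end
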